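/- Let $\mathcal{E}$ be a category and $T=(T,\, m\colon T^2\to T,\, i\colon 1_{\mathcal E}\to T)$ a monad on $\mathcal{E}$. A *$T$-graph* $(X_0,X_1,d_0,d_1)$ consists of objects $X_0,X_1$ of $\mathcal{E}$ and morphisms $d_0\colon X_1\to X_0$ and $d_1\colon X_1\to TX_0$. A morphism of $T$-graphs $X\to Y$ is a pair $(f_0\colon X_0\to Y_0,\ f_1\colon X_1\to Y_1)$ with $f_0d_0=d_0f_1$ and $Tf_0\circ d_1=d_1f_1$. These form the category $\mathbf{Gph}_T(\mathcal{E})$, with the functor $\mathrm{ob}\colon\mathbf{Gph}_T(\mathcal{E})\to\mathcal{E}$ sending $(X_0,X_1,d_0,d_1)$ to $X_0$. A *$T$-category* $X$ is a $T$-graph together with pullbacks $$X_2=X_1\times_{TX_0}TX_1 \text{ of } d_1\colon X_1\to TX_0 \text{ and } Td_0,\qquad X_3=X_2\times_{TX_1}TX_2 \text{ of } d_2\colon X_2\to TX_1 \text{ and } Td_0,$$ with projections $d_0\colon X_2\to X_1$, $d_2\colon X_2\to TX_1$ and $d_0\colon X_3\to X_2$, $d_3\colon X_3\to TX_2$, and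 with morphisms $d_1\colon X_2\to X_1$ and $s_0\colon X_0\to X_1$ such that * $d_0d_1=d_0d_0$ and $d_1d_1=m_{X_0}\circ Td_1\circ d_2$ as morphisms from $X_2$ to $X_0$ and to $TX_0$; * $d_0s_0=1_{X_0}$ and $d_1s_0=i_{X_0}$; * (associativity) $d_1d_1=d_1d_2\colon X_3\to X_1$, where $d_1,d_2\colon X_3\to X_2$ are determined by $d_0d_1=d_0d_0$, $d_2d_1=Td_1\circ d_3$ and by $d_0d_2=d_1d_0$, $d_2d_2=m_{X_1}\circ Td_2\circ d_3$; * (units) $d_1s_0=1_{X_1}=d_1s_1$, where $s_0,s_1\colon X_1\to X_2$ are determined by $d_0s_0=1_{X_1}$, $d_2s_0=Ts_0\circ d_1$ and by $d_0s_1=s_0d_0$, $d_2s_1=i_{X_1}$. A *$T$-functor* $X\to Y$ is a morphism $(f_0,f_1)$ of the underlying $T$-graphs with $f_1s_0=s_0f_0$ and $f_1d_1=d_1f_2$, where $f_2\colon X_2\to Y_2$ is determined by $d_0f_2=f_1d_0$ and $d_2f_2=Tf_1\circ d_2$. These form the category $\mathbf{Cat}_T(\mathcal{E})$, with its forgetful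 functor to $\mathbf{Gph}_T(\mathcal{E})$. **Theorem.** If $\mathcal{E}$ is locally finitely presentable and the functor $T\colon\mathcal{E}\to\mathcal{E}$ is finitary (that is, preserves filtered colimits), then the categories $\mathbf{Gph}_T(\mathcal{E})$ and $\mathbf{Cat}_T(\mathcal{E})$ are also locally finitely presentable, and both of the forgetful functors $$\mathbf{Cat}_T(\mathcal{E})\longrightarrow\mathbf{Gph}_T(\mathcal{E})\xrightarrow{\ \mathrm{ob}\ }\mathcal{E}$$ are finitary and are right adjoints (each has a left adjoint). -/

import Mathlib

open CategoryTheory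

universe v u

namespace TCat

/-- A `T`-graph: objects `X₀`, `X₁` of `E` with morphisms `d₀ : X₁ ⟶ X₀` and `d₁ : X₁ ⟶ T X₀`. -/
structure TGraph {E : Type u} [Category.{v} E] (T : Monad E) where
  X₀ : E
  X₁ : E
  d₀ : X₁ ⟶ X₀
  d₁ : X₁ ⟶ T.obj X₀

/-- A morphism of `T`-graphs. -/
@[ext]
structure TGraph.Hom {E : Type u} [Category.{v} E] {T : Monad E} (X Y : TGraph T) where
  f₀ : X.X₀ ⟶ Y.X₀
  f₁ : X.X₁ ⟶ Y.X₁
  comm_d₀ : X.d₀ ≫ f₀ = f₁ ≫ Y.d₀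
  comm_d₁ : X.d₁ ≫ T.map f₀ = f₁ ≫ Y.d₁

/-- The category `Gph_T(E)` of `T`-graphs. -/
instance TGraph.category {E : Type u} [Category.{v} E] (T : Monad E) : Category (TGraph T) where
  Hom X Y := TGraph.Hom X Y
  id X :=
    { f₀ := 𝟙 X.X₀
      f₁ := 𝟙 X.X₁
      comm_d₀ := by simp
      comm_d₁ := by simp }
  comp {X Y Z} f g :=
    { f₀ := f.f₀ ≫ g.f₀
      f₁ := f.f₁ ≫ g.f₁
      comm_d₀ := by rw [← Category.assoc, f.comm_d₀, Category.assoc, g.comm_d₀, Category.assoc]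
      comm_d₁ := by
        rw [T.map_comp, ← Category.assoc, f.comm_d₁, Category.assoc, g.comm_d₁, Category.assoc] }
  id_comp f := by apply TGraph.Hom.ext <;> exact Category.id_comp _
  comp_id f := by apply TGraph.Hom.ext <;> exact Category.comp_id _
  assoc f g h := by apply TGraph.Hom.ext <;> exact Category.assoc _ _ _

/-- The forgetful functor `ob : Gph_T(E) ⥤ E`, sending `(X₀, X₁, d₀, d₁)` to `X₀`. -/
def ob {E : Type u} [Category.{v} E] (T : Monad E) : TGraph T ⥤ E where
  obj X := X.X₀
  map f := f.f₀
  map_id _ := rfl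
  map_comp _ _ := rfl

/-- The data of a `T`-category, before the associativity and unit laws: a `T`-graph, the object
`X₂` of composable pairs (with its pullback square), a composition `d21 : X₂ ⟶ X₁`
and units `s₀ : X₀ ⟶ X₁` with the correct source and target, and the object `X₃` of composable
triples (with its pullback square). The morphism `dni` is the face map `d_i : X_n ⟶ X_{n-1}`
(with codomain `T X_{n-1}` when `i = n`). -/
structure TCategoryData {E : Type u} [Category.{v} E] (T : Monad E) extends TGraph T where
  X₂ : E
  d20 : X₂ ⟶ X₁
  d22 : X₂ ⟶ T.obj X₁
  isPullback₂ : IsPullback d20 d22 d₁ (T.map d₀)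
  /-- composition -/
  d21 : X₂ ⟶ X₁
  /-- units -/
  s₀ : X₀ ⟶ X₁
  d21_d₀ : d21 ≫ d₀ = d20 ≫ d₀
  d21_d₁ : d21 ≫ d₁ = d22 ≫ T.map d₁ ≫ T.μ.app X₀
  s₀_d₀ : s₀ ≫ d₀ = 𝟙 X₀
  s₀_d₁ : s₀ ≫ d₁ = T.η.app X₀
  X₃ : E
  d30 : X₃ ⟶ X₂
  d33 : X₃ ⟶ T.obj X₂
  isPullback₃ : IsPullback d30 d33 d22 (T.map d20)

namespace TCategoryData

/-- The face map `d₁ : X₃ ⟶ X₂`, determined by `d₀ ∘ d₁ = d₀ ∘ d₀` and `d₂ ∘ d₁ = T d₁ ∘ d₃`. -/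
noncomputable def d31 {E : Type u} [Category.{v} E] {T : Monad E} (X : TCategoryData T) :
    X.X₃ ⟶ X.X₂ :=
  X.isPullback₂.lift (X.d30 ≫ X.d20) (X.d33 ≫ T.map X.d21) (by
    rw [Category.assoc, Category.assoc, X.isPullback₂.w, ← T.map_comp, X.d21_d₀, T.map_comp,
      ← Category.assoc, X.isPullback₃.w, Category.assoc])

/-- The face map `d₂ : X₃ ⟶ X₂`, determined by `d₀ ∘ d₂ = d₁ ∘ d₀` and
`d₂ ∘ d₂ = m ∘ T d₂ ∘ d₃`. -/
noncomputable def d32 {E : Type u} [Category.{v} E] {T : Monad E} (X : TCategoryData T) :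
    X.X₃ ⟶ X.X₂ :=
  X.isPullback₂.lift (X.d30 ≫ X.d21) (X.d33 ≫ T.map X.d22 ≫ T.μ.app X.X₁) (by
    have h : T.μ.app X.X₁ ≫ T.map X.d₀ = T.map (T.map X.d₀) ≫ T.μ.app X.X₀ :=
      (T.μ.naturality X.d₀).symm
    have h' : T.map X.d22 ≫ T.map (T.map X.d₀) = T.map X.d20 ≫ T.map X.d₁ := by
      rw [← T.map_comp, ← X.isPullback₂.w, T.map_comp]
    simp only [Category.assoc]
    rw [h, X.d21_d₁, reassoc_of% h', ← Category.assoc, X.isPullback₃.w, Category.assoc])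

/-- The degeneracy `s₀ : X₁ ⟶ X₂`, determined by `d₀ ∘ s₀ = 1` and `d₂ ∘ s₀ = T s₀ ∘ d₁`. -/
noncomputable def s10 {E : Type u} [Category.{v} E] {T : Monad E} (X : TCategoryData T) :
    X.X₁ ⟶ X.X₂ :=
  X.isPullback₂.lift (𝟙 X.X₁) (X.d₁ ≫ T.map X.s₀) (by
    rw [Category.assoc, ← T.map_comp, X.s₀_d₀, T.map_id, Category.comp_id, Category.id_comp])

/-- The degeneracy `s₁ : X₁ ⟶ X₂`, determined by `d₀ ∘ s₁ = s₀ ∘ d₀` and `d₂ ∘ s₁ = i`. -/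
noncomputable def s11 {E : Type u} [Category.{v} E] {T : Monad E} (X : TCategoryData T) :
    X.X₁ ⟶ X.X₂ :=
  X.isPullback₂.lift (X.d₀ ≫ X.s₀) (T.η.app X.X₁) (by
    rw [Category.assoc, X.s₀_d₁]
    exact T.η.naturality X.d₀)

end TCategoryData

/-- A `T`-category. -/
structure TCategory {E : Type u} [Category.{v} E] (T : Monad E) extends TCategoryData T where
  assoc : toTCategoryData.d31 ≫ d21 = toTCategoryData.d32 ≫ d21
  s10_d21 : toTCategoryData.s10 ≫ d21 = 𝟙 X₁
  s11_d21 : toTCategoryData.s11 ≫ d21 = 𝟙 X₁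

/-- The morphism `f₂ : X₂ ⟶ Y₂` induced by a morphism `(f₀, f₁)` of underlying `T`-graphs,
determined by `d₀ ∘ f₂ = f₁ ∘ d₀` and `d₂ ∘ f₂ = T f₁ ∘ d₂`. -/
noncomputable def TCategoryData.f₂ {E : Type u} [Category.{v} E] {T : Monad E}
    {X Y : TCategoryData T} (f : X.toTGraph ⟶ Y.toTGraph) : X.X₂ ⟶ Y.X₂ :=
  Y.isPullback₂.lift (X.d20 ≫ f.f₁) (X.d22 ≫ T.map f.f₁) (by
    rw [Category.assoc, Category.assoc, ← T.map_comp, ← f.comm_d₁, ← f.comm_d₀, T.map_comp,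
      ← Category.assoc, X.isPullback₂.w, Category.assoc])

theorem TCategoryData.f₂_id {E : Type u} [Category.{v} E] {T : Monad E}
    (X : TCategoryData T) : TCategoryData.f₂ (𝟙 X.toTGraph) = 𝟙 X.X₂ := by
  apply X.isPullback₂.hom_ext
  · rw [TCategoryData.f₂, IsPullback.lift_fst, Category.id_comp]
    exact Category.comp_id _
  · rw [TCategoryData.f₂, IsPullback.lift_snd, Category.id_comp]
    exact (congrArg (X.d22 ≫ ·) (T.map_id X.X₁)).trans (Category.comp_id _)

theorem TCategoryData.f₂_comp {E : Type u} [Category.{v} E] {T : Monad E}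
    {X Y Z : TCategoryData T} (f : X.toTGraph ⟶ Y.toTGraph) (g : Y.toTGraph ⟶ Z.toTGraph) :
    TCategoryData.f₂ (f ≫ g) = TCategoryData.f₂ f ≫ TCategoryData.f₂ g := by
  have h : (f ≫ g).f₁ = f.f₁ ≫ g.f₁ := rfl
  apply Z.isPullback₂.hom_ext
  · simp only [TCategoryData.f₂, h, Category.assoc, IsPullback.lift_fst,
      IsPullback.lift_fst_assoc]
  · simp only [TCategoryData.f₂, h, Category.assoc, IsPullback.lift_snd,
      IsPullback.lift_snd_assoc, T.map_comp]

/-- A `T`-functor: a morphism of underlying `T`-graphs compatible with units and composition. -/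
@[ext]
structure TFunctor {E : Type u} [Category.{v} E] {T : Monad E} (X Y : TCategory T) where
  toHom : X.toTGraph ⟶ Y.toTGraph
  comm_s₀ : X.s₀ ≫ toHom.f₁ = toHom.f₀ ≫ Y.s₀
  comm_d21 : X.d21 ≫ toHom.f₁ = TCategoryData.f₂ toHom ≫ Y.d21

/-- The category `Cat_T(E)` of `T`-categories and `T`-functors. -/
instance TCategory.category {E : Type u} [Category.{v} E] (T : Monad E) :
    Category (TCategory T) where
  Hom X Y := TFunctor X Y
  id X :=
    { toHom := 𝟙 X.toTGraph
      comm_s₀ := (Category.comp_id X.s₀).trans (Category.id_comp X.s₀).symm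
      comm_d21 := by
        rw [TCategoryData.f₂_id, Category.id_comp]
        exact Category.comp_id _ }
  comp {X Y Z} f g :=
    { toHom := f.toHom ≫ g.toHom
      comm_s₀ := by
        change X.s₀ ≫ f.toHom.f₁ ≫ g.toHom.f₁ = (f.toHom.f₀ ≫ g.toHom.f₀) ≫ Z.s₀
        rw [← Category.assoc, f.comm_s₀, Category.assoc, g.comm_s₀, Category.assoc]
      comm_d21 := by
        rw [TCategoryData.f₂_comp]
        change X.d21 ≫ f.toHom.f₁ ≫ g.toHom.f₁ = _
        rw [← Category.assoc, f.comm_d21, Category.assoc, g.comm_d21, Category.assoc] }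
  id_comp f := TFunctor.ext (Category.id_comp f.toHom)
  comp_id f := TFunctor.ext (Category.comp_id f.toHom)
  assoc f g h := TFunctor.ext (Category.assoc f.toHom g.toHom h.toHom)

/-- The forgetful functor `Cat_T(E) ⥤ Gph_T(E)`, sending a `T`-category to its underlying
`T`-graph. -/
def forget {E : Type u} [Category.{v} E] (T : Monad E) : TCategory T ⥤ TGraph T where
  obj X := X.toTGraph
  map f := f.toHom
  map_id _ := rfl
  map_comp _ _ := rfl

end TCat

-- A full subcategory of a locally finitely presentable category cut out by orthogonality to a small
-- set of morphisms between finitely presentable objects is again locally finitely presentable,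
-- reflective, and closed under filtered colimits. The proof reaches $T$-categories from $T$-graphs
-- by a chain of such subcategories.
--
-- Colimits of $T$-graphs are computed on vertices and arrows, because $T$ occurs only in a
-- codomain. Graphs with finitely presentable vertices and arrows are finitely presentable since $T$
-- is finitary, and they contain a small strong generator. So $T$-graphs form a locally finitely
-- presentable category, and `ob` preserves colimits and has the discrete graphs as left adjoint.
--
-- Let $\Phi$ be the endofunctor `unitComp` of $T$-graphs that keeps $X_0$ and replaces $X_1$ by
-- $X_0+X_2$. It is finitary, because filtered colimits commute with pullbacks and coproducts. A
-- $\Phi$-algebra whose action is the identity on vertices is a graph with units and a composition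
-- having the right sources and targets. Three facts then suffice. (1) Algebras of a finitary
-- endofunctor are locally finitely presentable, with finitary right adjoint forgetful functor. They
-- are the pre-algebras $\Phi X\to Z\leftarrow X$ whose second leg is invertible; pre-algebras have
-- easily described colimits, and invertibility is an orthogonality condition
-- (`isFinitaryOrthogonalityClass_isAlgebra`). (2) The objects at which two natural transformations
-- $H\to U$ agree form an orthogonality class when $H$ and $U$ are finitary and $U$ is a right
-- adjoint (`isFinitaryOrthogonalityClass_equifier`). This gives triviality on vertices, then
-- associativity and the unit laws. (3) The outcome is equivalent to $T$-categories, compatibly with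
-- the forgetful functors; the choice of the pullbacks $X_2$, $X_3$ is immaterial (`toLawful`).

universe u'

section

open Limits Opposite Cardinal

attribute [local instance] fact_isRegular_aleph0

/-! ### Limits and filtered colimits in locally finitely presentable categories -/

namespace LFP

section

variable {K : Type u} [Category.{v} K]

/-- Finitely presentable objects are dense and essentially small, so the restricted Yoneda functor
is fully faithful; it has a left adjoint by cocompleteness. Thus `K` is reflective in a presheaf
category. This supplies the pullbacks defining $X_2$ and $X_3$. -/
theorem hasLimits [IsLocallyFinitelyPresentable.{v} K] : HasLimitsOfSize.{v, v} K := by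
  let F := (equivSmallModel.{v}
      (isCardinalPresentable K (ℵ₀ : Cardinal.{v})).FullSubcategory).inverse ⋙
    (isCardinalPresentable K (ℵ₀ : Cardinal.{v})).ι
  have : F.IsDense := inferInstance
  have adj := Presheaf.uliftYonedaAdjunction.{v} _ (uliftYoneda.{v}.leftKanExtensionUnit F)
  let : Reflective (Presheaf.restrictedULiftYoneda.{v} F) := ⟨_, adj⟩
  exact hasLimits_of_reflective (Presheaf.restrictedULiftYoneda.{v} F)

/-- In a locally finitely presentable category, finitely presentable objects detect
filtered colimits. -/
theorem nonempty_isColimit [IsLocallyFinitelyPresentable.{v} K] {J : Type v} [SmallCategory J]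
    [IsFiltered J] {D : J ⥤ K} (c : Cocone D)
    (hs : ∀ (G : K) [IsFinitelyPresentable.{v} G] (f : G ⟶ c.pt),
      ∃ (j : J) (g : G ⟶ D.obj j), g ≫ c.ι.app j = f)
    (hi : ∀ (G : K) [IsFinitelyPresentable.{v} G] (j : J) (f g : G ⟶ D.obj j),
      f ≫ c.ι.app j = g ≫ c.ι.app j → ∃ (k : J) (a : j ⟶ k), f ≫ D.map a = g ≫ D.map a) :
    Nonempty (IsColimit c) := by
  obtain ⟨P, _, hP⟩ := HasCardinalFilteredGenerator.exists_small_generator K (ℵ₀ : Cardinal.{v})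
  have hfp (G : K) (hG : P G) : IsFinitelyPresentable.{v} G := hP.le_isCardinalPresentable G hG
  have h := hP.isStrongGenerator
  -- Two maps from a generator into the colimit factor through a common stage, where `hi` merges
  -- them further on. Once the comparison is monic, `hs` and the strong generator make it
  -- invertible.
  have : Mono (colimit.desc D c) := by
    rw [h.isSeparating.mono_iff]
    intro G hG g₁ g₂ hg
    have := hfp G hG
    obtain ⟨j₁, f₁, rfl⟩ := IsFinitelyPresentable.exists_hom_of_isColimit (colimit.isColimit D) g₁
    obtain ⟨j₂, f₂, rfl⟩ := IsFinitelyPresentable.exists_hom_of_isColimit (colimit.isColimit D) g₂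
    obtain ⟨k, a, ha⟩ := hi G (IsFiltered.max j₁ j₂) (f₁ ≫ D.map (IsFiltered.leftToMax j₁ j₂))
      (f₂ ≫ D.map (IsFiltered.rightToMax j₁ j₂)) (by simpa using hg)
    have := congr($ha ≫ colimit.ι D k)
    simpa using this
  have : IsIso (colimit.desc D c) := h.isIso_of_mono _ (fun G hG f ↦ by
    have := hfp G hG
    obtain ⟨j, g, rfl⟩ := hs G f
    exact ⟨g ≫ colimit.ι D j, by simp⟩)
  exact ⟨IsColimit.ofIsoColimit (colimit.isColimit _) (Cocone.ext (asIso (colimit.desc _ c)))⟩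

variable {L : Type*} [Category* L]

theorem isFinitelyAccessible_of_forall {F : L ⥤ K}
    (h : ∀ (J : Type v) [SmallCategory J] [IsFiltered J] (D : J ⥤ L) (c : Cocone D),
      IsColimit c → Nonempty (IsColimit (F.mapCocone c))) : F.IsFinitelyAccessible.{v} := by
  rw [Functor.IsFinitelyAccessible_iff_preservesFilteredColimitsOfSize]
  exact ⟨fun J _ _ ↦ ⟨⟨fun hc ↦ h J _ _ hc⟩⟩⟩

/-- Filtered colimits commute with pullbacks, as tested on finitely presentable `G`: a map from `G`
to `P` of the colimit is a pair of maps into `A` and `B` agreeing in `C`. Each member factors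
through a stage, and they agree in `C` at a later stage. -/
theorem isFinitelyAccessible_of_isPullback {K : Type u} [Category.{v} K]
    [IsLocallyFinitelyPresentable.{v} K] {P A B C : L ⥤ K}
    [A.IsFinitelyAccessible.{v}] [B.IsFinitelyAccessible.{v}] [C.IsFinitelyAccessible.{v}]
    {p : P ⟶ A} {q : P ⟶ B} {f : A ⟶ C} {g : B ⟶ C}
    (h : ∀ X, IsPullback (p.app X) (q.app X) (f.app X) (g.app X)) :
    P.IsFinitelyAccessible.{v} := by
  refine isFinitelyAccessible_of_forall fun J _ _ D c hc ↦ ?_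
  have hfilt : IsCardinalFiltered J (ℵ₀ : Cardinal.{v}) := by
    rw [isCardinalFiltered_aleph0_iff]; infer_instance
  have (F : L ⥤ K) [F.IsFinitelyAccessible.{v}] : IsColimit (F.mapCocone c) :=
    have := F.preservesColimitsOfShape_of_isCardinalAccessible (ℵ₀ : Cardinal.{v}) J
    isColimitOfPreserves F hc
  have hA := this A
  have hB := this B
  have hC := this C
  refine nonempty_isColimit _ (fun G _ t ↦ ?_) (fun G _ j s t hst ↦ ?_)
  · change G ⟶ P.obj c.pt at t
    obtain ⟨j₁, a, ha⟩ := IsFinitelyPresentable.exists_hom_of_isColimit hA (t ≫ p.app c.pt)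
    obtain ⟨j₂, b, hb⟩ := IsFinitelyPresentable.exists_hom_of_isColimit hB (t ≫ q.app c.pt)
    dsimp at a b ha hb
    obtain ⟨k, u, w, huw⟩ := IsFinitelyPresentable.exists_eq_of_isColimit hC
      (a ≫ f.app _) (b ≫ g.app _) (by
        dsimp
        rw [Category.assoc, Category.assoc, ← f.naturality, ← g.naturality, reassoc_of% ha,
          reassoc_of% hb, (h c.pt).w])
    dsimp at huw
    refine ⟨k, (h (D.obj k)).lift (a ≫ A.map (D.map u)) (b ≫ B.map (D.map w)) ?_, ?_⟩
    · simpa using huw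
    · apply (h c.pt).hom_ext
      · dsimp
        rw [Category.assoc, p.naturality, IsPullback.lift_fst_assoc, Category.assoc,
          ← A.map_comp, c.w, ha]
      · dsimp
        rw [Category.assoc, q.naturality, IsPullback.lift_snd_assoc, Category.assoc,
          ← B.map_comp, c.w, hb]
  · change G ⟶ P.obj (D.obj j) at s t
    dsimp at hst
    obtain ⟨k₁, u, hu⟩ := IsCardinalPresentable.exists_eq_of_isColimit' (ℵ₀ : Cardinal.{v}) hA
      (s ≫ p.app _) (t ≫ p.app _) (by
        dsimp; rw [Category.assoc, Category.assoc, ← p.naturality, reassoc_of% hst])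
    obtain ⟨k₂, w, hw⟩ := IsCardinalPresentable.exists_eq_of_isColimit' (ℵ₀ : Cardinal.{v}) hB
      (s ≫ q.app _) (t ≫ q.app _) (by
        dsimp; rw [Category.assoc, Category.assoc, ← q.naturality, reassoc_of% hst])
    obtain ⟨k, u', w', huw⟩ := IsFiltered.span u w
    refine ⟨k, u ≫ u', ?_⟩
    dsimp at hu hw ⊢
    simp only [Category.assoc] at hu hw
    apply (h (D.obj k)).hom_ext
    · simp [reassoc_of% hu]
    · rw [huw]
      simp [reassoc_of% hw]

end

end LFP

/-! ### Finitary orthogonality classes and equifiers -/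

namespace LFP

variable {K : Type u} [Category.{v} K] {G : Type u'} [Category.{v} G]

/-- An object property that is a small orthogonality class with respect to morphisms between
finitely presentable objects. -/
def IsFinitaryOrthogonalityClass (P : ObjectProperty K) : Prop :=
  ∃ (W : MorphismProperty K), MorphismProperty.IsSmall.{v} W ∧
    (∀ ⦃X Y : K⦄ (f : X ⟶ Y), W f → IsFinitelyPresentable.{v} X ∧ IsFinitelyPresentable.{v} Y) ∧
    P = W.isLocal

namespace IsFinitaryOrthogonalityClass

theorem iInf {ι : Type} {P : ι → ObjectProperty K}
    (h : ∀ i, IsFinitaryOrthogonalityClass (P i)) :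
    IsFinitaryOrthogonalityClass (⨅ i, P i) := by
  choose W h₁ h₂ h₃ using h
  refine ⟨⨆ i, W i, inferInstance, fun X Y f hf ↦ ?_, ?_⟩
  · rw [MorphismProperty.iSup_iff] at hf
    obtain ⟨i, hi⟩ := hf
    exact h₂ i f hi
  · rw [MorphismProperty.isLocal_iSup]
    exact iInf_congr h₃

variable [IsLocallyFinitelyPresentable.{v} K] {P : ObjectProperty K}
  (hP : IsFinitaryOrthogonalityClass P)

include hP

theorem isLocallyFinitelyPresentable : IsLocallyFinitelyPresentable.{v} P.FullSubcategory := by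
  obtain ⟨W, _, h, rfl⟩ := hP
  exact W.isLocallyPresentable_isLocal _ h

theorem isFinitelyAccessible_ι : P.ι.IsFinitelyAccessible.{v} := by
  obtain ⟨W, _, h, rfl⟩ := hP
  exact W.isCardinalAccessible_ι_isLocal _ h

theorem isRightAdjoint_ι : P.ι.IsRightAdjoint := by
  obtain ⟨W, _, h, rfl⟩ := hP
  exact W.isRightAdjoint_ι_isLocal _ h

end IsFinitaryOrthogonalityClass

theorem isFinitelyPresentable_coequalizer [HasCoequalizers K] {A B : K}
    [IsFinitelyPresentable.{v} A] [IsFinitelyPresentable.{v} B] (f g : A ⟶ B) :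
    IsFinitelyPresentable.{v} (coequalizer f g) := by
  have (k : WalkingParallelPair) :
      IsCardinalPresentable ((parallelPair f g).obj k) (ℵ₀ : Cardinal.{v}) := by
    cases k <;> dsimp <;> infer_instance
  exact isCardinalPresentable_of_isColimit.{v} _ (colimit.isColimit (parallelPair f g))
    (ℵ₀ : Cardinal.{v}) (by rw [hasCardinalLT_aleph0_iff]; infer_instance)

/-- The objects at which two natural transformations `H ⟶ U` agree. -/
def equifier {H U : K ⥤ G} (α β : H ⟶ U) : ObjectProperty K := fun X ↦ α.app X = β.app X

/-- Since `X` is a filtered colimit of generators `A` and `H` preserves it, equality at `X` can be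
tested on composites `B ⟶ H A ⟶ H X` with `B` a generator of `G`. By adjunction, each `B ⟶ H A`
yields two maps from the free object on `B` to `A`, and the test says that every `A ⟶ X` coequalizes
them. That is orthogonality of `X` to their coequalizer. The free object on `B` is finitely
presentable because `U` is finitary. -/
theorem isFinitaryOrthogonalityClass_equifier
    [IsLocallyFinitelyPresentable.{v} K] [IsLocallyFinitelyPresentable.{v} G] {H U : K ⥤ G}
    [H.IsFinitelyAccessible.{v}] [U.IsFinitelyAccessible.{v}] [U.IsRightAdjoint] (α β : H ⟶ U) :
    IsFinitaryOrthogonalityClass (equifier α β) := by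
  obtain ⟨P, _, hP⟩ := HasCardinalFilteredGenerator.exists_small_generator K (ℵ₀ : Cardinal.{v})
  obtain ⟨Q, _, hQ⟩ := HasCardinalFilteredGenerator.exists_small_generator G (ℵ₀ : Cardinal.{v})
  let adj := Adjunction.ofIsRightAdjoint U
  let ι := Σ (A : Subtype P) (B : Subtype Q), B.1 ⟶ H.obj A.1
  let s (i : ι) : U.leftAdjoint.obj i.2.1.1 ⟶ i.1.1 :=
    (adj.homEquiv _ _).symm (i.2.2 ≫ α.app i.1.1)
  let t (i : ι) : U.leftAdjoint.obj i.2.1.1 ⟶ i.1.1 :=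
    (adj.homEquiv _ _).symm (i.2.2 ≫ β.app i.1.1)
  refine ⟨MorphismProperty.ofHoms (fun i : ι ↦ coequalizer.π (s i) (t i)), inferInstance, ?_, ?_⟩
  · rintro _ _ _ ⟨i⟩
    have h₁ : IsFinitelyPresentable.{v} i.1.1 := hP.le_isCardinalPresentable _ i.1.2
    have : IsFinitelyPresentable.{v} i.2.1.1 := hQ.le_isCardinalPresentable _ i.2.1.2
    have : IsFinitelyPresentable.{v} (U.leftAdjoint.obj i.2.1.1) :=
      adj.isCardinalPresentable_leftAdjoint_obj _ _
    exact ⟨h₁, isFinitelyPresentable_coequalizer _ _⟩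
  · ext X
    refine ⟨fun (hX : α.app X = β.app X) ↦ ?_, fun hX ↦ ?_⟩
    · rintro _ _ _ ⟨i⟩
      refine ⟨fun f g hfg ↦ by simpa [cancel_epi] using hfg, fun f ↦ ?_⟩
      have h : s i ≫ f = t i ≫ f := by
        apply (adj.homEquiv _ _).injective
        simp [s, t, Adjunction.homEquiv_naturality_right, ← NatTrans.naturality, hX]
      exact ⟨coequalizer.desc f h, coequalizer.π_desc f h⟩
    · change α.app X = β.app X
      apply hQ.isStrongGenerator.isSeparating
      intro B hB b
      have : IsFinitelyPresentable.{v} B := hQ.le_isCardinalPresentable _ hB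
      obtain ⟨J, _, _, ⟨p⟩⟩ := hP.exists_colimitsOfShape X
      have := H.preservesColimitsOfShape_of_isCardinalAccessible (ℵ₀ : Cardinal.{v}) J
      obtain ⟨j, b, rfl⟩ := IsCardinalPresentable.exists_hom_of_isColimit (ℵ₀ : Cardinal.{v})
        (isColimitOfPreserves H p.isColimit) b
      let i : ι := ⟨⟨_, p.prop_diag_obj j⟩, ⟨B, hB⟩, b⟩
      obtain ⟨g, hg⟩ := (hX _ (MorphismProperty.ofHoms.mk i)).2 (p.ι.app j)
      have h : s i ≫ p.ι.app j = t i ≫ p.ι.app j := by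
        rw [← hg]
        exact coequalizer.condition_assoc _ _ _
      have := congr(adj.homEquiv _ _ $h)
      simpa [s, t, i, Adjunction.homEquiv_naturality_right] using this

end LFP

/-! ### Pre-algebras and algebras of a finitary endofunctor -/

namespace LFP

variable {K : Type u} [Category.{v} K]

/-- A cocomplete category with a jointly faithful and jointly conservative family of finitary
right adjoints to locally finitely presentable categories is locally finitely presentable. -/
theorem isLocallyFinitelyPresentable_of_family {L : Type u'} [Category.{v} L]
    [HasColimitsOfSize.{v, v} L] [IsLocallyFinitelyPresentable.{v} K] {ι : Type} (U : ι → L ⥤ K)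
    [∀ i, (U i).IsFinitelyAccessible.{v}] [∀ i, (U i).IsRightAdjoint]
    (hf : ∀ {A B : L} (f g : A ⟶ B), (∀ i, (U i).map f = (U i).map g) → f = g)
    (hc : ∀ {A B : L} (f : A ⟶ B), (∀ i, IsIso ((U i).map f)) → IsIso f) :
    IsLocallyFinitelyPresentable.{v} L := by
  obtain ⟨P, _, hP⟩ := HasCardinalFilteredGenerator.exists_small_generator K (ℵ₀ : Cardinal.{v})
  let adj (i : ι) := Adjunction.ofIsRightAdjoint (U i)
  -- The strong generator consists of the free objects on generators of `K`, one for each functor of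
  -- the family. Transposition turns maps out of them into maps `G ⟶ U i A`; faithfulness gives
  -- separation and conservativity gives strength.
  let s (k : ι × Subtype P) : L := (U k.1).leftAdjoint.obj k.2.1
  have hs : (ObjectProperty.ofObj s).IsStrongGenerator := by
    rw [ObjectProperty.isStrongGenerator_iff]
    refine ⟨fun A B f g h ↦ hf f g fun i ↦ ?_, fun A B f _ h ↦ hc f fun i ↦ ?_⟩
    · apply hP.isStrongGenerator.isSeparating
      intro G hG t
      have := h _ (ObjectProperty.ofObj_apply s (i, ⟨G, hG⟩)) (((adj i).homEquiv _ _).symm t)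
      have := congr((adj i).homEquiv _ _ $this)
      simpa [Adjunction.homEquiv_naturality_right] using this
    · refine hP.isStrongGenerator.isIso_of_mono _ fun G hG t ↦ ?_
      obtain ⟨r, hr⟩ := h _ (ObjectProperty.ofObj_apply s (i, ⟨G, hG⟩))
        (((adj i).homEquiv _ _).symm t)
      refine ⟨(adj i).homEquiv _ _ r, ?_⟩
      have := congr((adj i).homEquiv _ _ $hr)
      simpa [Adjunction.homEquiv_naturality_right] using this
  refine (IsCardinalLocallyPresentable.iff_exists_isStrongGenerator L _).2
    ⟨_, inferInstance, hs, ?_⟩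
  rintro _ ⟨i, G, hG⟩
  have : IsFinitelyPresentable.{v} G := hP.le_isCardinalPresentable G hG
  exact (adj i).isCardinalPresentable_leftAdjoint_obj _ _

/-- A colimit of a diagram given by its objects and morphisms. -/
structure FamilyColimit {J : Type*} [Category* J] {o : J → K}
    (m : ∀ ⦃i j : J⦄, (i ⟶ j) → (o i ⟶ o j)) where
  pt : K
  ι (j : J) : o j ⟶ pt
  w ⦃i j : J⦄ (f : i ⟶ j) : m f ≫ ι j = ι i
  desc {T : K} (s : ∀ j, o j ⟶ T) (hs : ∀ ⦃i j : J⦄ (f : i ⟶ j), m f ≫ s j = s i) : pt ⟶ T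
  fac {T : K} (s : ∀ j, o j ⟶ T) (hs : ∀ ⦃i j : J⦄ (f : i ⟶ j), m f ≫ s j = s i) (j : J) :
    ι j ≫ desc s hs = s j
  hom_ext {T : K} {f g : pt ⟶ T} (h : ∀ j, ι j ≫ f = ι j ≫ g) : f = g

namespace FamilyColimit

variable {J : Type*} [Category* J]

/-- The chosen colimit of a functor. -/
noncomputable def ofFunctor (H : J ⥤ K) [HasColimit H] :
    FamilyColimit (o := H.obj) (fun _ _ f ↦ H.map f) where
  pt := colimit H
  ι j := colimit.ι H j
  w _ _ f := colimit.w H f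
  desc s hs := colimit.desc H { pt := _, ι := { app := s, naturality _ _ f := by simp [hs] } }
  fac s hs j := by simp
  hom_ext h := colimit.hom_ext h

/-- A cocone that is isomorphic to a colimit is a colimit. -/
def isColimit {H : J ⥤ K} (D : FamilyColimit (o := H.obj) (fun _ _ f ↦ H.map f)) (c : Cocone H)
    (e : D.pt ≅ c.pt) (he : ∀ j, D.ι j ≫ e.hom = c.ι.app j) : IsColimit c where
  desc s := e.inv ≫ D.desc (fun j ↦ s.ι.app j) (fun _ _ f ↦ s.w f)
  fac s j := by rw [← he, Category.assoc, e.hom_inv_id_assoc, D.fac]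
  uniq s t ht := by
    rw [Iso.eq_inv_comp]
    apply D.hom_ext
    intro j
    rw [D.fac, ← ht, ← he, Category.assoc]

end FamilyColimit

/-- A pair of objects `X` and `Z` with morphisms `X ⟶ Z` and `Φ X ⟶ Z`; this is an algebra
of `Φ` when `X ⟶ Z` is an isomorphism. -/
structure PreAlgebra (Φ : K ⥤ K) where
  X : K
  Z : K
  u : Φ.obj X ⟶ Z
  v : X ⟶ Z

namespace PreAlgebra

/-- A morphism of pre-algebras. -/
@[ext]
structure Hom {Φ : K ⥤ K} (A B : PreAlgebra Φ) where
  x : A.X ⟶ B.X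
  z : A.Z ⟶ B.Z
  hu : A.u ≫ z = Φ.map x ≫ B.u
  hv : A.v ≫ z = x ≫ B.v

instance (Φ : K ⥤ K) : Category (PreAlgebra Φ) where
  Hom := Hom
  id A := { x := 𝟙 _, z := 𝟙 _, hu := by simp, hv := by simp }
  comp f g :=
    { x := f.x ≫ g.x
      z := f.z ≫ g.z
      hu := by rw [Φ.map_comp, Category.assoc, ← g.hu, ← Category.assoc, f.hu, Category.assoc]
      hv := by rw [Category.assoc, ← g.hv, ← Category.assoc, f.hv, Category.assoc] }
  id_comp f := by apply Hom.ext <;> exact Category.id_comp _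
  comp_id f := by apply Hom.ext <;> exact Category.comp_id _
  assoc f g h := by apply Hom.ext <;> exact Category.assoc _ _ _

variable {Φ : K ⥤ K}

@[ext]
theorem hom_ext {A B : PreAlgebra Φ} {f g : A ⟶ B} (hx : f.x = g.x) (hz : f.z = g.z) : f = g :=
  Hom.ext hx hz

@[simp]
theorem comp_x {A B C : PreAlgebra Φ} (f : A ⟶ B) (g : B ⟶ C) : (f ≫ g).x = f.x ≫ g.x := rfl

@[simp]
theorem comp_z {A B C : PreAlgebra Φ} (f : A ⟶ B) (g : B ⟶ C) : (f ≫ g).z = f.z ≫ g.z := rfl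

@[simp]
theorem id_x (A : PreAlgebra Φ) : Hom.x (𝟙 A) = 𝟙 A.X := rfl

@[simp]
theorem id_z (A : PreAlgebra Φ) : Hom.z (𝟙 A) = 𝟙 A.Z := rfl

variable (Φ) in
/-- The functor sending a pre-algebra to its first object. -/
def fst : PreAlgebra Φ ⥤ K where
  obj A := A.X
  map f := f.x

variable (Φ) in
/-- The functor sending a pre-algebra to its second object. -/
def snd : PreAlgebra Φ ⥤ K where
  obj A := A.Z
  map f := f.z

theorem isIso_of_isIso {A B : PreAlgebra Φ} (f : A ⟶ B) (_ : IsIso f.x) (_ : IsIso f.z) : IsIso f :=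
  ⟨⟨{ x := inv f.x
      z := inv f.z
      hu := by rw [IsIso.comp_inv_eq, Category.assoc, f.hu, ← Φ.map_comp_assoc]; simp
      hv := by rw [IsIso.comp_inv_eq, Category.assoc, f.hv]; simp }, by cat_disch, by cat_disch⟩⟩

section Colimits

variable [HasColimitsOfSize.{v, v} K] {J : Type v} [SmallCategory J] (F : J ⥤ PreAlgebra Φ)

/-- The colimit of the first objects. -/
noncomputable def colimitX : FamilyColimit (o := fun j ↦ (F.obj j).X) (fun _ _ f ↦ (F.map f).x) :=
  .ofFunctor (F ⋙ fst Φ)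

/-- The colimit of the second objects. -/
noncomputable def colimitZ : FamilyColimit (o := fun j ↦ (F.obj j).Z) (fun _ _ f ↦ (F.map f).z) :=
  .ofFunctor (F ⋙ snd Φ)

/-- The colimit of the images of the first objects. -/
noncomputable def colimitΦX :
    FamilyColimit (o := fun j ↦ Φ.obj (F.obj j).X) (fun _ _ f ↦ Φ.map (F.map f).x) :=
  .ofFunctor ((F ⋙ fst Φ) ⋙ Φ)

/-- The comparison morphism for `Φ`. -/
noncomputable def colimitPost : (colimitΦX F).pt ⟶ Φ.obj (colimitX F).pt :=
  (colimitΦX F).desc (fun j ↦ Φ.map ((colimitX F).ι j)) (fun i j f ↦ by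
    rw [← Φ.map_comp, (colimitX F).w])

/-- The morphism induced by the structure morphisms `Φ X ⟶ Z`. -/
noncomputable def colimitU : (colimitΦX F).pt ⟶ (colimitZ F).pt :=
  (colimitΦX F).desc (fun j ↦ (F.obj j).u ≫ (colimitZ F).ι j) (fun i j f ↦ by
    rw [← Category.assoc, ← (F.map f).hu, Category.assoc, (colimitZ F).w])

/-- The morphism induced by the structure morphisms `X ⟶ Z`. -/
noncomputable def colimitV : (colimitX F).pt ⟶ (colimitZ F).pt :=
  (colimitX F).desc (fun j ↦ (F.obj j).v ≫ (colimitZ F).ι j) (fun i j f ↦ by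
    rw [← Category.assoc, ← (F.map f).hv, Category.assoc, (colimitZ F).w])

theorem ι_colimitPost (j : J) :
    (colimitΦX F).ι j ≫ colimitPost F = Φ.map ((colimitX F).ι j) := (colimitΦX F).fac _ _ j

theorem ι_colimitU (j : J) :
    (colimitΦX F).ι j ≫ colimitU F = (F.obj j).u ≫ (colimitZ F).ι j := (colimitΦX F).fac _ _ j

theorem ι_colimitV (j : J) :
    (colimitX F).ι j ≫ colimitV F = (F.obj j).v ≫ (colimitZ F).ι j := (colimitX F).fac _ _ j

/-- The colimit cocone of a diagram of pre-algebras. -/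
noncomputable def colimitCocone : Cocone F where
  pt :=
    { X := (colimitX F).pt
      -- As `Φ` need not preserve the colimit, the colimit of the second objects only receives a map
      -- from the colimit of the `Φ X`; pushing out along the comparison gives the required map from
      -- `Φ` of the colimit.
      Z := pushout (colimitU F) (colimitPost F)
      u := pushout.inr _ _
      v := colimitV F ≫ pushout.inl _ _ }
  ι :=
    { app j :=
        { x := (colimitX F).ι j
          z := (colimitZ F).ι j ≫ pushout.inl _ _
          hu := by
            rw [← Category.assoc, ← ι_colimitU, Category.assoc, pushout.condition,
              ← Category.assoc, ι_colimitPost]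
            rfl
          hv := by
            rw [← Category.assoc, ← ι_colimitV, Category.assoc]
            rfl }
      naturality i j f := by
        apply hom_ext
        · exact ((colimitX F).w f).trans (Category.comp_id _).symm
        · exact ((Category.assoc _ _ _).symm.trans (congrArg (· ≫ _) ((colimitZ F).w f))).trans
            (Category.comp_id _).symm }

/-- The morphism from the colimit of the first objects induced by a cocone. -/
noncomputable def colimitDescX (s : Cocone F) : (colimitX F).pt ⟶ s.pt.X :=
  (colimitX F).desc (fun j ↦ (s.ι.app j).x) (fun _ _ f ↦ congr(Hom.x $(s.w f)))

/-- The morphism from the colimit of the second objects induced by a cocone. -/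
noncomputable def colimitDescZ (s : Cocone F) : (colimitZ F).pt ⟶ s.pt.Z :=
  (colimitZ F).desc (fun j ↦ (s.ι.app j).z) (fun _ _ f ↦ congr(Hom.z $(s.w f)))

theorem ι_colimitDescX (s : Cocone F) (j : J) :
    (colimitX F).ι j ≫ colimitDescX F s = (s.ι.app j).x := (colimitX F).fac _ _ j

theorem ι_colimitDescZ (s : Cocone F) (j : J) :
    (colimitZ F).ι j ≫ colimitDescZ F s = (s.ι.app j).z := (colimitZ F).fac _ _ j

/-- The morphism from the colimit induced by a cocone. -/
noncomputable def colimitDesc (s : Cocone F) : (colimitCocone F).pt ⟶ s.pt where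
    x := colimitDescX F s
    z := pushout.desc (colimitDescZ F s) (Φ.map (colimitDescX F s) ≫ s.pt.u) (by
      apply (colimitΦX F).hom_ext
      intro j
      rw [← Category.assoc, ι_colimitU, ← Category.assoc, ι_colimitPost, Category.assoc,
        ι_colimitDescZ, ← Φ.map_comp_assoc, ι_colimitDescX]
      exact (s.ι.app j).hu)
    hu := pushout.inr_desc _ _ _
    hv := by
      refine (Category.assoc _ _ _).trans ?_
      refine (congrArg (colimitV F ≫ ·) (pushout.inl_desc _ _ _)).trans ?_
      apply (colimitX F).hom_ext
      intro j
      rw [← Category.assoc, ι_colimitV, Category.assoc, ι_colimitDescZ]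
      refine (s.ι.app j).hv.trans ?_
      rw [← ι_colimitDescX]
      exact Category.assoc _ _ _

/-- `colimitCocone F` is a colimit cocone. -/
noncomputable def isColimitColimitCocone : IsColimit (colimitCocone F) where
  desc s := colimitDesc F s
  fac s j := by
    apply hom_ext
    · exact ι_colimitDescX F s j
    · refine (Category.assoc _ _ _).trans ?_
      refine (congrArg ((colimitZ F).ι j ≫ ·) (pushout.inl_desc _ _ _)).trans ?_
      exact ι_colimitDescZ F s j
  uniq s m hm := by
    have hx : m.x = (colimitDesc F s).x := by
      apply (colimitX F).hom_ext
      intro j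
      exact congr(Hom.x $(hm j)).trans (ι_colimitDescX F s j).symm
    apply hom_ext
    · exact hx
    · apply pushout.hom_ext
      · refine Eq.trans ?_ (pushout.inl_desc _ _ _).symm
        apply (colimitZ F).hom_ext
        intro j
        refine Eq.trans ?_ (ι_colimitDescZ F s j).symm
        exact (Category.assoc _ _ _).symm.trans congr(Hom.z $(hm j))
      · refine m.hu.trans (Eq.trans ?_ (colimitDesc F s).hu.symm)
        rw [hx]

instance : HasColimitsOfSize.{v, v} (PreAlgebra Φ) where
  has_colimits_of_shape _ _ := { has_colimit F := ⟨_, isColimitColimitCocone F⟩ }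

instance : (fst Φ).IsFinitelyAccessible.{v} :=
  isFinitelyAccessible_of_forall fun _ _ _ F _ hc ↦
    have : PreservesColimit F (fst Φ) :=
      preservesColimit_of_preserves_colimit_cocone (isColimitColimitCocone F)
        ((colimitX F).isColimit _ (Iso.refl _) (fun _ ↦ Category.comp_id _))
    ⟨isColimitOfPreserves _ hc⟩

theorem isIso_colimitPost [PreservesColimitsOfShape J Φ] : IsIso (colimitPost F) := by
  have : colimitPost F = colimit.post (F ⋙ fst Φ) Φ := by
    apply (colimitΦX F).hom_ext
    intro j
    exact (ι_colimitPost F j).trans (colimit.ι_post (F ⋙ fst Φ) Φ j).symm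
  rw [this]
  exact inferInstanceAs (IsIso (colimit.post (F ⋙ fst Φ) Φ))

/-- For a filtered diagram the comparison `colimitPost` is invertible, so the pushout in the colimit
pre-algebra is just the colimit of the second objects. -/
instance [Φ.IsFinitelyAccessible.{v}] : (snd Φ).IsFinitelyAccessible.{v} := by
  refine isFinitelyAccessible_of_forall fun J _ _ F _ hc ↦ ?_
  have hfilt : IsCardinalFiltered J (ℵ₀ : Cardinal.{v}) := by
    rw [isCardinalFiltered_aleph0_iff]; infer_instance
  have := Φ.preservesColimitsOfShape_of_isCardinalAccessible (ℵ₀ : Cardinal.{v}) J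
  have := isIso_colimitPost F
  have : IsIso (pushout.inl (colimitU F) (colimitPost F)) :=
    (IsPushout.of_hasPushout (colimitU F) (colimitPost F)).isIso_inl_of_isIso
  let e : (colimitZ F).pt ≅ pushout (colimitU F) (colimitPost F) := asIso (pushout.inl _ _)
  have : PreservesColimit F (snd Φ) :=
    preservesColimit_of_preserves_colimit_cocone (isColimitColimitCocone F)
      ((colimitZ F).isColimit _ e (fun _ ↦ rfl))
  exact ⟨isColimitOfPreserves _ hc⟩

/-- The free pre-algebra on a first object. -/
noncomputable def freeFst (Φ : K ⥤ K) (G : K) : PreAlgebra Φ where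
  X := G
  Z := G ⨿ Φ.obj G
  u := coprod.inr
  v := coprod.inl

/-- The free pre-algebra on a second object. -/
noncomputable def freeSnd (Φ : K ⥤ K) (G : K) : PreAlgebra Φ where
  X := ⊥_ K
  Z := G ⨿ Φ.obj (⊥_ K)
  u := coprod.inr
  v := initial.to _

/-- The universal property of `freeFst`. -/
noncomputable def freeFstHomEquiv (G : K) (A : PreAlgebra Φ) : (freeFst Φ G ⟶ A) ≃ (G ⟶ A.X) where
  toFun f := f.x
  invFun g :=
    { x := g
      z := coprod.desc (g ≫ A.v) (Φ.map g ≫ A.u)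
      hu := coprod.inr_desc _ _
      hv := coprod.inl_desc _ _ }
  left_inv f := by
    apply hom_ext
    · rfl
    · apply coprod.hom_ext
      · exact (coprod.inl_desc _ _).trans f.hv.symm
      · exact (coprod.inr_desc _ _).trans f.hu.symm
  right_inv g := rfl

/-- The universal property of `freeSnd`. -/
noncomputable def freeSndHomEquiv (G : K) (A : PreAlgebra Φ) : (freeSnd Φ G ⟶ A) ≃ (G ⟶ A.Z) where
  toFun f := coprod.inl ≫ f.z
  invFun g :=
    { x := initial.to _
      z := coprod.desc g (Φ.map (initial.to _) ≫ A.u)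
      hu := coprod.inr_desc _ _
      hv := initial.hom_ext _ _ }
  left_inv f := by
    apply hom_ext
    · exact initial.hom_ext _ _
    · apply coprod.hom_ext
      · exact coprod.inl_desc _ _
      · refine (coprod.inr_desc _ _).trans (Eq.trans ?_ f.hu.symm)
        rw [initial.hom_ext (initial.to A.X) f.x]
        rfl
  right_inv g := coprod.inl_desc _ _

theorem freeSndHomEquiv_naturality {G : K} {A B : PreAlgebra Φ} (f : freeSnd Φ G ⟶ A)
    (g : A ⟶ B) : freeSndHomEquiv G B (f ≫ g) = freeSndHomEquiv G A f ≫ g.z :=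
  (Category.assoc _ _ _).symm

/-- `freeFst` is left adjoint to `fst`. -/
noncomputable def freeFstAdj : Adjunction.leftAdjointOfEquiv (G := fst Φ) freeFstHomEquiv
    (fun _ _ _ _ _ ↦ rfl) ⊣ fst Φ :=
  Adjunction.adjunctionOfEquivLeft _ _

/-- `freeSnd` is left adjoint to `snd`. -/
noncomputable def freeSndAdj : Adjunction.leftAdjointOfEquiv (G := snd Φ) freeSndHomEquiv
    (fun _ _ _ _ _ ↦ (Category.assoc _ _ _).symm) ⊣ snd Φ :=
  Adjunction.adjunctionOfEquivLeft _ _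

instance : (fst Φ).IsRightAdjoint := freeFstAdj.isRightAdjoint

instance : (snd Φ).IsRightAdjoint := freeSndAdj.isRightAdjoint

end Colimits

instance [IsLocallyFinitelyPresentable.{v} K] [Φ.IsFinitelyAccessible.{v}] :
    IsLocallyFinitelyPresentable.{v} (PreAlgebra Φ) := by
  let U (b : Bool) : PreAlgebra Φ ⥤ K := bif b then fst Φ else snd Φ
  have (b : Bool) : (U b).IsFinitelyAccessible.{v} := by
    cases b <;> dsimp [U] <;> infer_instance
  have (b : Bool) : (U b).IsRightAdjoint := by cases b <;> dsimp [U] <;> infer_instance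
  refine isLocallyFinitelyPresentable_of_family U (fun f g h ↦ hom_ext (h true) (h false))
    (fun f h ↦ ?_)
  exact isIso_of_isIso f (h true) (h false)

variable (Φ) in
/-- The pre-algebras that come from algebras. -/
def isAlgebra : ObjectProperty (PreAlgebra Φ) := fun A ↦ IsIso A.v

/-- Maps from `freeFst Φ G` and `freeSnd Φ G` to `A` are maps from `G` to `A.X` and `A.Z`, and
precomposition with `w G` becomes composition with `A.v`. Orthogonality to `w G` therefore says that
`A.v` is bijective on maps from `G`; over a strong generator this means that `A.v` is invertible. -/
theorem isFinitaryOrthogonalityClass_isAlgebra [IsLocallyFinitelyPresentable.{v} K]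
    [Φ.IsFinitelyAccessible.{v}] : IsFinitaryOrthogonalityClass (isAlgebra Φ) := by
  obtain ⟨P, _, hP⟩ := HasCardinalFilteredGenerator.exists_small_generator K (ℵ₀ : Cardinal.{v})
  let w (G : Subtype P) : freeSnd Φ G.1 ⟶ freeFst Φ G.1 :=
    (freeSndHomEquiv G.1 (freeFst Φ G.1)).symm coprod.inl
  refine ⟨MorphismProperty.ofHoms w, inferInstance, ?_, ?_⟩
  · rintro _ _ _ ⟨G⟩
    have : IsFinitelyPresentable.{v} G.1 := hP.le_isCardinalPresentable _ G.2
    exact ⟨freeSndAdj.isCardinalPresentable_leftAdjoint_obj _ _,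
      freeFstAdj.isCardinalPresentable_leftAdjoint_obj _ _⟩
  · have key (G : Subtype P) (A : PreAlgebra Φ) (g : freeFst Φ G.1 ⟶ A) :
        freeSndHomEquiv _ _ (w G ≫ g) = freeFstHomEquiv _ _ g ≫ A.v := by
      refine (freeSndHomEquiv_naturality _ _).trans ?_
      exact (congrArg (· ≫ g.z) (Equiv.apply_symm_apply _ _)).trans g.hv
    ext A
    refine ⟨fun (hA : IsIso A.v) ↦ ?_, fun hA ↦ ?_⟩
    · rintro _ _ _ ⟨G⟩
      refine ⟨fun f g hfg ↦ ?_, fun f ↦ ?_⟩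
      · replace hfg := congr(freeSndHomEquiv _ _ $hfg)
        dsimp only at hfg
        rw [key, key, cancel_mono] at hfg
        exact (freeFstHomEquiv _ _).injective hfg
      · refine ⟨(freeFstHomEquiv _ _).symm (freeSndHomEquiv _ _ f ≫ inv A.v), ?_⟩
        apply (freeSndHomEquiv _ _).injective
        dsimp only
        rw [key, Equiv.apply_symm_apply, Category.assoc, IsIso.inv_hom_id, Category.comp_id]
    · have : Mono A.v := by
        rw [hP.isStrongGenerator.isSeparating.mono_iff]
        intro G hG f g hfg
        apply (freeFstHomEquiv _ _).symm.injective
        apply (hA _ (MorphismProperty.ofHoms.mk ⟨G, hG⟩)).1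
        apply (freeSndHomEquiv _ _).injective
        dsimp only
        refine (key ⟨G, hG⟩ _ _).trans (Eq.trans ?_ (key ⟨G, hG⟩ _ _).symm)
        rw [Equiv.apply_symm_apply, Equiv.apply_symm_apply, hfg]
      refine hP.isStrongGenerator.isIso_of_mono _ fun G hG t ↦ ?_
      obtain ⟨f, hf⟩ := (hA _ (MorphismProperty.ofHoms.mk ⟨G, hG⟩)).2
        ((freeSndHomEquiv _ _).symm t)
      refine ⟨freeFstHomEquiv _ _ f, ?_⟩
      dsimp only at hf ⊢
      rw [← key ⟨G, hG⟩, hf, Equiv.apply_symm_apply]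

variable (Φ) in
/-- Algebras as pre-algebras. -/
def ofAlgebra : Endofunctor.Algebra Φ ⥤ PreAlgebra Φ where
  obj A := { X := A.a, Z := A.a, u := A.str, v := 𝟙 _ }
  map f := { x := f.f, z := f.f, hu := f.h.symm, hv := by simp }

variable (Φ) in
/-- Algebras as a full subcategory of pre-algebras. -/
def ofAlgebraLift : Endofunctor.Algebra Φ ⥤ (isAlgebra Φ).FullSubcategory :=
  (isAlgebra Φ).lift (ofAlgebra Φ) fun A ↦ inferInstanceAs (IsIso (𝟙 A.a))

instance : (ofAlgebra Φ).Faithful where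
  map_injective h := Endofunctor.Algebra.ext congr(Hom.x $h)

instance : (ofAlgebra Φ).Full where
  map_surjective {A B} f := by
    have h : f.z = f.x :=
      (Category.id_comp _).symm.trans (f.hv.trans (Category.comp_id _))
    exact ⟨{ f := f.x, h := f.hu.symm.trans (congrArg (A.str ≫ ·) h) }, hom_ext rfl h.symm⟩

instance : (ofAlgebraLift Φ).IsEquivalence where
  faithful := 
    Functor.Faithful.of_comp_iso ((isAlgebra Φ).liftCompιIso (ofAlgebra Φ) _)
  full := 
    Functor.Full.of_comp_faithful_iso ((isAlgebra Φ).liftCompιIso (ofAlgebra Φ) _)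
  essSurj := ⟨fun ⟨A, (hA : IsIso A.v)⟩ ↦ by
    -- Transporting `Z` to `X` along the inverse of `A.v` turns the pre-algebra into an algebra.
    let B : Endofunctor.Algebra Φ := ⟨A.X, A.u ≫ inv A.v⟩
    let f : (ofAlgebra Φ).obj B ⟶ A :=
      { x := 𝟙 _
        z := A.v
        hu := by
          refine (Category.assoc _ _ _).trans ?_
          refine (congrArg (A.u ≫ ·) (IsIso.inv_hom_id A.v)).trans ((Category.comp_id _).trans ?_)
          exact ((congrArg (· ≫ A.u) (Φ.map_id A.X)).trans (Category.id_comp _)).symm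
        hv := rfl }
    have := isIso_of_isIso f (inferInstanceAs (IsIso (𝟙 A.X))) hA
    let e : (ofAlgebra Φ).obj B ≅ A := asIso f
    exact ⟨B, ⟨(isAlgebra Φ).isoMk e⟩⟩⟩

end PreAlgebra

section

variable (Φ : K ⥤ K) [IsLocallyFinitelyPresentable.{v} K] [Φ.IsFinitelyAccessible.{v}]

instance isLocallyFinitelyPresentable_algebra :
    IsLocallyFinitelyPresentable.{v} (Endofunctor.Algebra Φ) :=
  have := PreAlgebra.isFinitaryOrthogonalityClass_isAlgebra (Φ := Φ).isLocallyFinitelyPresentable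
  (PreAlgebra.ofAlgebraLift Φ).asEquivalence.symm.isCardinalLocallyPresentable _

instance isFinitelyAccessible_algebraForget :
    (Endofunctor.Algebra.forget Φ).IsFinitelyAccessible.{v} :=
  have := PreAlgebra.isFinitaryOrthogonalityClass_isAlgebra (Φ := Φ).isFinitelyAccessible_ι
  inferInstanceAs ((PreAlgebra.ofAlgebraLift Φ ⋙ (PreAlgebra.isAlgebra Φ).ι) ⋙
    PreAlgebra.fst Φ).IsFinitelyAccessible

instance isRightAdjoint_algebraForget :
    (Endofunctor.Algebra.forget Φ).IsRightAdjoint :=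
  have := PreAlgebra.isFinitaryOrthogonalityClass_isAlgebra (Φ := Φ).isRightAdjoint_ι
  inferInstanceAs ((PreAlgebra.ofAlgebraLift Φ ⋙ (PreAlgebra.isAlgebra Φ).ι) ⋙
    PreAlgebra.fst Φ).IsRightAdjoint

end

end LFP

open LFP

/-! ### Presentability of the category of `T`-graphs -/

namespace TCat

variable {E : Type u} [Category.{v} E] {T : Monad E}

namespace TGraph

@[ext]
theorem hom_ext {X Y : TGraph T} {f g : X ⟶ Y} (h₀ : f.f₀ = g.f₀) (h₁ : f.f₁ = g.f₁) : f = g :=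
  Hom.ext h₀ h₁

@[simp]
theorem comp_f₀ {X Y Z : TGraph T} (f : X ⟶ Y) (g : Y ⟶ Z) : (f ≫ g).f₀ = f.f₀ ≫ g.f₀ := rfl

@[simp]
theorem comp_f₁ {X Y Z : TGraph T} (f : X ⟶ Y) (g : Y ⟶ Z) : (f ≫ g).f₁ = f.f₁ ≫ g.f₁ := rfl

@[simp]
theorem id_f₀ (X : TGraph T) : Hom.f₀ (𝟙 X) = 𝟙 X.X₀ := rfl

@[simp]
theorem id_f₁ (X : TGraph T) : Hom.f₁ (𝟙 X) = 𝟙 X.X₁ := rfl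

theorem isIso_of_isIso {X Y : TGraph T} (f : X ⟶ Y) (_ : IsIso f.f₀) (_ : IsIso f.f₁) : IsIso f :=
  ⟨⟨{ f₀ := inv f.f₀
      f₁ := inv f.f₁
      comm_d₀ := by rw [IsIso.comp_inv_eq, Category.assoc, f.comm_d₀, IsIso.inv_hom_id_assoc]
      comm_d₁ := by
        rw [IsIso.eq_inv_comp, ← reassoc_of% f.comm_d₁, ← T.map_comp, IsIso.hom_inv_id, T.map_id,
          Category.comp_id] },
    hom_ext (IsIso.hom_inv_id f.f₀) (IsIso.hom_inv_id f.f₁),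
    hom_ext (IsIso.inv_hom_id f.f₀) (IsIso.inv_hom_id f.f₁)⟩⟩

end TGraph

variable (T) in
/-- The functor sending a `T`-graph to its object of arrows. -/
def arr : TGraph T ⥤ E where
  obj X := X.X₁
  map f := f.f₁

namespace TGraph

section Colimits

variable [HasColimitsOfSize.{v, v} E] {J : Type v} [SmallCategory J] (F : J ⥤ TGraph T)

/-- The colimit of the objects of vertices. -/
noncomputable def colimit₀ :
    FamilyColimit (o := fun j ↦ (F.obj j).X₀) (fun _ _ f ↦ (F.map f).f₀) :=
  .ofFunctor (F ⋙ ob T)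

/-- The colimit of the objects of arrows. -/
noncomputable def colimit₁ :
    FamilyColimit (o := fun j ↦ (F.obj j).X₁) (fun _ _ f ↦ (F.map f).f₁) :=
  .ofFunctor (F ⋙ arr T)

theorem colimit_compat₀ ⦃i j : J⦄ (f : i ⟶ j) :
    (F.map f).f₁ ≫ (F.obj j).d₀ ≫ (colimit₀ F).ι j = (F.obj i).d₀ ≫ (colimit₀ F).ι i := by
  rw [← reassoc_of% (F.map f).comm_d₀, (colimit₀ F).w]

theorem colimit_compat₁ ⦃i j : J⦄ (f : i ⟶ j) :
    (F.map f).f₁ ≫ (F.obj j).d₁ ≫ T.map ((colimit₀ F).ι j) =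
      (F.obj i).d₁ ≫ T.map ((colimit₀ F).ι i) := by
  rw [← reassoc_of% (F.map f).comm_d₁, ← T.map_comp, (colimit₀ F).w]

/-- The colimit of a diagram of `T`-graphs. -/
noncomputable def colimitObj : TGraph T where
  X₀ := (colimit₀ F).pt
  X₁ := (colimit₁ F).pt
  d₀ := (colimit₁ F).desc _ (colimit_compat₀ F)
  d₁ := (colimit₁ F).desc _ (colimit_compat₁ F)

/-- The colimit cocone of a diagram of `T`-graphs. -/
noncomputable def colimitCocone : Cocone F where
  pt := colimitObj F
  ι :=
    { app j :=
        { f₀ := (colimit₀ F).ι j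
          f₁ := (colimit₁ F).ι j
          comm_d₀ := ((colimit₁ F).fac _ (colimit_compat₀ F) j).symm
          comm_d₁ := ((colimit₁ F).fac _ (colimit_compat₁ F) j).symm }
      naturality i j f := by
        apply hom_ext
        · exact ((colimit₀ F).w f).trans (Category.comp_id _).symm
        · exact ((colimit₁ F).w f).trans (Category.comp_id _).symm }

/-- The morphism on vertices induced by a cocone. -/
noncomputable def colimitDesc₀ (s : Cocone F) : (colimit₀ F).pt ⟶ s.pt.X₀ :=
  (colimit₀ F).desc (fun j ↦ (s.ι.app j).f₀) (fun _ _ f ↦ congr(Hom.f₀ $(s.w f)))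

/-- The morphism on arrows induced by a cocone. -/
noncomputable def colimitDesc₁ (s : Cocone F) : (colimit₁ F).pt ⟶ s.pt.X₁ :=
  (colimit₁ F).desc (fun j ↦ (s.ι.app j).f₁) (fun _ _ f ↦ congr(Hom.f₁ $(s.w f)))

theorem ι_colimitDesc₀ (s : Cocone F) (j : J) :
    (colimit₀ F).ι j ≫ colimitDesc₀ F s = (s.ι.app j).f₀ := (colimit₀ F).fac _ _ j

theorem ι_colimitDesc₁ (s : Cocone F) (j : J) :
    (colimit₁ F).ι j ≫ colimitDesc₁ F s = (s.ι.app j).f₁ := (colimit₁ F).fac _ _ j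

theorem colimitDesc_comm₀ (s : Cocone F) :
    (colimit₁ F).desc _ (colimit_compat₀ F) ≫ colimitDesc₀ F s = colimitDesc₁ F s ≫ s.pt.d₀ := by
  apply (colimit₁ F).hom_ext
  intro j
  rw [← Category.assoc, (colimit₁ F).fac, Category.assoc, ι_colimitDesc₀, ← Category.assoc,
    ι_colimitDesc₁]
  exact (s.ι.app j).comm_d₀

theorem colimitDesc_comm₁ (s : Cocone F) :
    (colimit₁ F).desc _ (colimit_compat₁ F) ≫ T.map (colimitDesc₀ F s) =
      colimitDesc₁ F s ≫ s.pt.d₁ := by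
  apply (colimit₁ F).hom_ext
  intro j
  rw [← Category.assoc, (colimit₁ F).fac, Category.assoc, ← T.map_comp, ι_colimitDesc₀,
    ← Category.assoc, ι_colimitDesc₁]
  exact (s.ι.app j).comm_d₁

/-- `colimitCocone F` is a colimit cocone. -/
noncomputable def isColimitColimitCocone : IsColimit (colimitCocone F) where
  desc s :=
    { f₀ := colimitDesc₀ F s
      f₁ := colimitDesc₁ F s
      comm_d₀ := colimitDesc_comm₀ F s
      comm_d₁ := colimitDesc_comm₁ F s }
  fac s j := hom_ext (ι_colimitDesc₀ F s j) (ι_colimitDesc₁ F s j)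
  uniq s m hm := by
    apply hom_ext
    · apply (colimit₀ F).hom_ext
      intro j
      exact congr(Hom.f₀ $(hm j)).trans (ι_colimitDesc₀ F s j).symm
    · apply (colimit₁ F).hom_ext
      intro j
      exact congr(Hom.f₁ $(hm j)).trans (ι_colimitDesc₁ F s j).symm

instance : HasColimitsOfSize.{v, v} (TGraph T) where
  has_colimits_of_shape _ _ := { has_colimit F := ⟨_, isColimitColimitCocone F⟩ }

instance : PreservesColimitsOfSize.{v, v} (ob T) where
  preservesColimitsOfShape {_ _} :=
    { preservesColimit {F} :=
        preservesColimit_of_preserves_colimit_cocone (isColimitColimitCocone F)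
          ((colimit₀ F).isColimit _ (Iso.refl _) (fun _ ↦ Category.comp_id _)) }

instance : PreservesColimitsOfSize.{v, v} (arr T) where
  preservesColimitsOfShape {_ _} :=
    { preservesColimit {F} :=
        preservesColimit_of_preserves_colimit_cocone (isColimitColimitCocone F)
          ((colimit₁ F).isColimit _ (Iso.refl _) (fun _ ↦ Category.comp_id _)) }

/-- Colimits of `T`-graphs are detected on vertices and arrows. -/
theorem nonempty_isColimit {F : J ⥤ TGraph T} (c : Cocone F)
    (h₀ : Nonempty (IsColimit ((ob T).mapCocone c)))
    (h₁ : Nonempty (IsColimit ((arr T).mapCocone c))) : Nonempty (IsColimit c) := by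
  have hc := colimit.isColimit F
  let f := hc.desc c
  have h₀' : (ob T).map f =
      ((isColimitOfPreserves (ob T) hc).coconePointUniqueUpToIso h₀.some).hom :=
    (isColimitOfPreserves (ob T) hc).hom_ext fun j ↦ by
      rw [IsColimit.comp_coconePointUniqueUpToIso_hom]
      exact congr((ob T).map $(hc.fac c j))
  have h₁' : (arr T).map f =
      ((isColimitOfPreserves (arr T) hc).coconePointUniqueUpToIso h₁.some).hom :=
    (isColimitOfPreserves (arr T) hc).hom_ext fun j ↦ by
      rw [IsColimit.comp_coconePointUniqueUpToIso_hom]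
      exact congr((arr T).map $(hc.fac c j))
  have : IsIso f := isIso_of_isIso f (by change IsIso ((ob T).map f); rw [h₀']; infer_instance)
    (by change IsIso ((arr T).map f); rw [h₁']; infer_instance)
  exact ⟨hc.ofIsoColimit (Cocone.ext (asIso f) (fun j ↦ hc.fac c j))⟩

/-- The `T`-graph without arrows on an object of vertices. -/
noncomputable def disc (T : Monad E) (G : E) : TGraph T where
  X₀ := G
  X₁ := ⊥_ E
  d₀ := initial.to _
  d₁ := initial.to _

/-- The universal property of `disc`. -/
noncomputable def discHomEquiv (G : E) (X : TGraph T) : (disc T G ⟶ X) ≃ (G ⟶ X.X₀) where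
  toFun f := f.f₀
  invFun g :=
    { f₀ := g
      f₁ := initial.to _
      comm_d₀ := initial.hom_ext _ _
      comm_d₁ := initial.hom_ext _ _ }
  left_inv _ := hom_ext rfl (initial.hom_ext _ _)
  right_inv _ := rfl

/-- `disc` is left adjoint to `ob`. -/
noncomputable def discAdj : Adjunction.leftAdjointOfEquiv (G := ob T) discHomEquiv
    (fun _ _ _ _ _ ↦ rfl) ⊣ ob T :=
  Adjunction.adjunctionOfEquivLeft _ _

instance : (ob T).IsRightAdjoint := discAdj.isRightAdjoint

end Colimits

/-- Every generalized arrow of a `T`-graph lies in the image of a finitely presentable graph. -/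
theorem exists_hom_f₁_eq [T.toFunctor.IsFinitelyAccessible.{v}] {P : ObjectProperty E}
    (hP : P.IsCardinalFilteredGenerator (ℵ₀ : Cardinal.{v})) (X : TGraph T) {G : E}
    [IsFinitelyPresentable.{v} G] (t : G ⟶ X.X₁) :
    ∃ (A : E) (_ : P A) (d₀ : G ⟶ A) (d₁ : G ⟶ T.obj A) (a : A ⟶ X.X₀),
      d₀ ≫ a = t ≫ X.d₀ ∧ d₁ ≫ T.map a = t ≫ X.d₁ := by
  obtain ⟨J, _, _, ⟨p⟩⟩ := hP.exists_colimitsOfShape X.X₀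
  have hfilt : IsFiltered J := isFiltered_of_isCardinalFiltered J (ℵ₀ : Cardinal.{v})
  have := T.toFunctor.preservesColimitsOfShape_of_isCardinalAccessible (ℵ₀ : Cardinal.{v}) J
  have hT := isColimitOfPreserves T.toFunctor p.isColimit
  -- Source and target of `t` factor separately through stages of the colimit $X_0$ and of its image
  -- under `T`; any common later stage serves as the vertices.
  obtain ⟨j₀, a, ha⟩ := IsFinitelyPresentable.exists_hom_of_isColimit p.isColimit (t ≫ X.d₀)
  obtain ⟨j₁, b, hb⟩ := IsFinitelyPresentable.exists_hom_of_isColimit hT (t ≫ X.d₁)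
  refine ⟨p.diag.obj (IsFiltered.max j₀ j₁), p.prop_diag_obj _,
    a ≫ p.diag.map (IsFiltered.leftToMax j₀ j₁),
    b ≫ T.map (p.diag.map (IsFiltered.rightToMax j₀ j₁)),
    p.ι.app _, ?_, ?_⟩
  · simpa using ha
  · rw [Category.assoc, ← T.map_comp, p.w]
    exact hb

section

variable [IsLocallyFinitelyPresentable.{v} E]

/-- Functors to `T`-graphs are finitary if they are so on vertices and arrows. -/
theorem isFinitelyAccessible_of_comp {L : Type*} [Category* L] (F : L ⥤ TGraph T)
    [(F ⋙ ob T).IsFinitelyAccessible.{v}] [(F ⋙ arr T).IsFinitelyAccessible.{v}] :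
    F.IsFinitelyAccessible.{v} := by
  refine isFinitelyAccessible_of_forall fun J _ _ D c hc ↦ ?_
  have hfilt : IsCardinalFiltered J (ℵ₀ : Cardinal.{v}) := by
    rw [isCardinalFiltered_aleph0_iff]; infer_instance
  have := (F ⋙ ob T).preservesColimitsOfShape_of_isCardinalAccessible (ℵ₀ : Cardinal.{v}) J
  have := (F ⋙ arr T).preservesColimitsOfShape_of_isCardinalAccessible (ℵ₀ : Cardinal.{v}) J
  exact nonempty_isColimit _ ⟨isColimitOfPreserves (F ⋙ ob T) hc⟩
    ⟨isColimitOfPreserves (F ⋙ arr T) hc⟩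

variable [T.toFunctor.IsFinitelyAccessible.{v}]

/-- A map to a filtered colimit factors through stages on vertices and on arrows. Compatibility with
`d₀`, and with `d₁` because `T` preserves the colimit, are equations between maps out of `X.X₁`, so
both hold at some later stage. -/
theorem isFinitelyPresentable (X : TGraph T) [IsFinitelyPresentable.{v} X.X₀]
    [IsFinitelyPresentable.{v} X.X₁] : IsFinitelyPresentable.{v} X := by
  refine isFinitelyAccessible_of_forall fun J _ _ D c hc ↦ ?_
  have hfilt : IsCardinalFiltered J (ℵ₀ : Cardinal.{v}) := by
    rw [isCardinalFiltered_aleph0_iff]; infer_instance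
  have := T.toFunctor.preservesColimitsOfShape_of_isCardinalAccessible (ℵ₀ : Cardinal.{v}) J
  have h₀ := isColimitOfPreserves (ob T) hc
  have h₁ := isColimitOfPreserves (arr T) hc
  have hT := isColimitOfPreserves T.toFunctor h₀
  refine ⟨Types.FilteredColimit.isColimitOf' _ _ (fun (f : X ⟶ c.pt) ↦ ?_)
    (fun j (f g : X ⟶ D.obj j) h ↦ ?_)⟩
  · obtain ⟨j₀, g₀, hg₀⟩ : ∃ (j : J) (g : X.X₀ ⟶ (D.obj j).X₀), g ≫ (c.ι.app j).f₀ = f.f₀ :=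
      IsFinitelyPresentable.exists_hom_of_isColimit h₀ f.f₀
    obtain ⟨j₁, g₁, hg₁⟩ : ∃ (j : J) (g : X.X₁ ⟶ (D.obj j).X₁), g ≫ (c.ι.app j).f₁ = f.f₁ :=
      IsFinitelyPresentable.exists_hom_of_isColimit h₁ f.f₁
    obtain ⟨k, u, w, huw⟩ : ∃ (k : J) (u : j₀ ⟶ k) (w : j₁ ⟶ k),
        (X.d₀ ≫ g₀) ≫ (D.map u).f₀ = (g₁ ≫ (D.obj j₁).d₀) ≫ (D.map w).f₀ :=
      IsFinitelyPresentable.exists_eq_of_isColimit h₀ (X.d₀ ≫ g₀) (g₁ ≫ (D.obj j₁).d₀) (by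
        change (X.d₀ ≫ g₀) ≫ (c.ι.app j₀).f₀ = (g₁ ≫ (D.obj j₁).d₀) ≫ (c.ι.app j₁).f₀
        rw [Category.assoc, hg₀, Category.assoc, (c.ι.app j₁).comm_d₀, reassoc_of% hg₁]
        exact f.comm_d₀)
    obtain ⟨k', t, ht⟩ : ∃ (k' : J) (t : k ⟶ k'),
        (X.d₁ ≫ T.map (g₀ ≫ (D.map u).f₀)) ≫ T.map (D.map t).f₀ =
          (g₁ ≫ (D.obj j₁).d₁ ≫ T.map (D.map w).f₀) ≫ T.map (D.map t).f₀ :=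
      IsCardinalPresentable.exists_eq_of_isColimit' (ℵ₀ : Cardinal.{v}) hT
        (X.d₁ ≫ T.map (g₀ ≫ (D.map u).f₀)) (g₁ ≫ (D.obj j₁).d₁ ≫ T.map (D.map w).f₀) (by
        change (X.d₁ ≫ T.map (g₀ ≫ (D.map u).f₀)) ≫ T.map (c.ι.app k).f₀ =
          (g₁ ≫ (D.obj j₁).d₁ ≫ T.map (D.map w).f₀) ≫ T.map (c.ι.app k).f₀
        have hu : (D.map u).f₀ ≫ (c.ι.app k).f₀ = (c.ι.app j₀).f₀ := congr(Hom.f₀ $(c.w u))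
        have hw : (D.map w).f₀ ≫ (c.ι.app k).f₀ = (c.ι.app j₁).f₀ := congr(Hom.f₀ $(c.w w))
        rw [Category.assoc, ← T.map_comp, Category.assoc, hu, hg₀, Category.assoc, Category.assoc,
          ← T.map_comp, hw, (c.ι.app j₁).comm_d₁, reassoc_of% hg₁]
        exact f.comm_d₁)
    refine ⟨k',
      { f₀ := g₀ ≫ (D.map (u ≫ t)).f₀
        f₁ := g₁ ≫ (D.map (w ≫ t)).f₁
        comm_d₀ := ?_
        comm_d₁ := ?_ }, ?_⟩
    · rw [Category.assoc, ← (D.map (w ≫ t)).comm_d₀, D.map_comp, D.map_comp, comp_f₀, comp_f₀]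
      simpa using congr($huw ≫ (D.map t).f₀)
    · rw [Category.assoc, ← (D.map (w ≫ t)).comm_d₁, D.map_comp, D.map_comp, comp_f₀, comp_f₀]
      simpa using ht
    · apply hom_ext
      · refine hg₀.symm.trans (Eq.trans ?_ (Category.assoc _ _ _).symm)
        exact congr(g₀ ≫ Hom.f₀ $((c.w (u ≫ t)).symm))
      · refine hg₁.symm.trans (Eq.trans ?_ (Category.assoc _ _ _).symm)
        exact congr(g₁ ≫ Hom.f₁ $((c.w (w ≫ t)).symm))
  · change X ⟶ D.obj j at f g
    replace h : f ≫ c.ι.app j = g ≫ c.ι.app j := h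
    obtain ⟨k₀, u, hu⟩ : ∃ (k : J) (u : j ⟶ k), f.f₀ ≫ (D.map u).f₀ = g.f₀ ≫ (D.map u).f₀ :=
      IsCardinalPresentable.exists_eq_of_isColimit' (ℵ₀ : Cardinal.{v}) h₀ f.f₀ g.f₀
        congr(Hom.f₀ $h)
    obtain ⟨k₁, w, hw⟩ : ∃ (k : J) (w : j ⟶ k), f.f₁ ≫ (D.map w).f₁ = g.f₁ ≫ (D.map w).f₁ :=
      IsCardinalPresentable.exists_eq_of_isColimit' (ℵ₀ : Cardinal.{v}) h₁ f.f₁ g.f₁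
        congr(Hom.f₁ $h)
    obtain ⟨k, u', w', huw⟩ := IsFiltered.span u w
    refine ⟨k, u ≫ u', ?_⟩
    change f ≫ D.map (u ≫ u') = g ≫ D.map (u ≫ u')
    apply hom_ext
    · rw [D.map_comp]
      simp [reassoc_of% hu]
    · rw [huw, D.map_comp]
      simp [reassoc_of% hw]

/-- Discrete graphs on generators detect vertices, and graphs with generators as vertices and arrows
detect arrows. The criterion by a family of right adjoints is unsuitable here, since `arr` need not
have a left adjoint. -/
instance : IsLocallyFinitelyPresentable.{v} (TGraph T) := by
  obtain ⟨P, _, hP⟩ := HasCardinalFilteredGenerator.exists_small_generator E (ℵ₀ : Cardinal.{v})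
  have hfp (G : Subtype P) : IsFinitelyPresentable.{v} G.1 := hP.le_isCardinalPresentable G.1 G.2
  let ι := Subtype P ⊕ (Σ (A : Subtype P) (B : Subtype P), (B.1 ⟶ A.1) × (B.1 ⟶ T.obj A.1))
  let s (i : ι) : TGraph T := i.elim (fun G ↦ disc T G.1) (fun i ↦
    { X₀ := i.1.1, X₁ := i.2.1.1, d₀ := i.2.2.1, d₁ := i.2.2.2 })
  have hs : (ObjectProperty.ofObj s).IsStrongGenerator := by
    rw [ObjectProperty.isStrongGenerator_iff]
    refine ⟨fun X Y _ _ h ↦ ?_, fun X Y f _ h ↦ ?_⟩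
    · apply hom_ext
      · apply hP.isStrongGenerator.isSeparating
        intro G hG t
        exact congr(Hom.f₀ $(h _ (ObjectProperty.ofObj_apply s (.inl ⟨G, hG⟩))
          ((discHomEquiv _ _).symm t)))
      · apply hP.isStrongGenerator.isSeparating
        intro G hG t
        have := hfp ⟨G, hG⟩
        obtain ⟨A, hA, d₀, d₁, a, h₀, h₁⟩ := exists_hom_f₁_eq hP X t
        exact congr(Hom.f₁ $(h _ (ObjectProperty.ofObj_apply s
          (.inr ⟨⟨A, hA⟩, ⟨G, hG⟩, d₀, d₁⟩)) { f₀ := a, f₁ := t, comm_d₀ := h₀, comm_d₁ := h₁ }))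
    · have hf₀ : Mono f.f₀ := inferInstanceAs (Mono ((ob T).map f))
      -- Vertices come first: `T` need not preserve monomorphisms, but it preserves this
      -- isomorphism. Hence arrows `t`, `t'` with the same image under `f` have the same source and
      -- target, and so are images of one test graph.
      have : IsIso f.f₀ := hP.isStrongGenerator.isIso_of_mono _ fun G hG t ↦ by
        obtain ⟨r, hr⟩ := h _ (ObjectProperty.ofObj_apply s (.inl ⟨G, hG⟩))
          ((discHomEquiv _ _).symm t)
        exact ⟨r.f₀, congr(Hom.f₀ $hr)⟩
      have : Mono f.f₁ := by
        rw [hP.isStrongGenerator.isSeparating.mono_iff]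
        intro G hG t t' htt'
        have := hfp ⟨G, hG⟩
        obtain ⟨A, hA, d₀, d₁, a, h₀, h₁⟩ := exists_hom_f₁_eq hP X t
        have h₀' : d₀ ≫ a = t' ≫ X.d₀ := by
          rw [← cancel_mono f.f₀, h₀, Category.assoc, f.comm_d₀, reassoc_of% htt', Category.assoc,
            f.comm_d₀]
        have h₁' : d₁ ≫ T.map a = t' ≫ X.d₁ := by
          rw [← cancel_mono (T.map f.f₀), h₁, Category.assoc, f.comm_d₁, reassoc_of% htt',
            Category.assoc, f.comm_d₁]
        let Y := s (.inr ⟨⟨A, hA⟩, ⟨G, hG⟩, d₀, d₁⟩)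
        let r : Y ⟶ X := { f₀ := a, f₁ := t, comm_d₀ := h₀, comm_d₁ := h₁ }
        let r' : Y ⟶ X := { f₀ := a, f₁ := t', comm_d₀ := h₀', comm_d₁ := h₁' }
        have hr : r ≫ f = r' ≫ f := hom_ext rfl htt'
        rw [cancel_mono] at hr
        exact congr(Hom.f₁ $hr)
      have : IsIso f.f₁ := hP.isStrongGenerator.isIso_of_mono _ fun G hG t ↦ by
        have := hfp ⟨G, hG⟩
        obtain ⟨A, hA, d₀, d₁, a, h₀, h₁⟩ := exists_hom_f₁_eq hP Y t
        obtain ⟨r, hr⟩ := h _ (ObjectProperty.ofObj_apply s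
          (.inr ⟨⟨A, hA⟩, ⟨G, hG⟩, d₀, d₁⟩)) { f₀ := a, f₁ := t, comm_d₀ := h₀, comm_d₁ := h₁ }
        exact ⟨r.f₁, congr(Hom.f₁ $hr)⟩
      exact isIso_of_isIso f inferInstance inferInstance
  refine (IsCardinalLocallyPresentable.iff_exists_isStrongGenerator (TGraph T) _).2
    ⟨_, inferInstance, hs, ?_⟩
  rintro _ ⟨G | ⟨A, B, d₀, d₁⟩⟩
  · exact discAdj.isCardinalPresentable_leftAdjoint_obj (ℵ₀ : Cardinal.{v}) G.1
  · have : IsFinitelyPresentable.{v} (s (.inr ⟨A, B, d₀, d₁⟩)).X₀ := hfp A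
    have : IsFinitelyPresentable.{v} (s (.inr ⟨A, B, d₀, d₁⟩)).X₁ := hfp B
    exact isFinitelyPresentable _

end

end TGraph

end TCat

/-! ### Sources, targets and naturality of the structure maps -/

namespace TCat

variable {E : Type u} [Category.{v} E] {T : Monad E}

namespace TCategoryData

section

variable (X : TCategoryData T)

theorem d31_d20 : X.d31 ≫ X.d20 = X.d30 ≫ X.d20 := X.isPullback₂.lift_fst _ _ _

theorem d31_d22 : X.d31 ≫ X.d22 = X.d33 ≫ T.map X.d21 := X.isPullback₂.lift_snd _ _ _

theorem d32_d20 : X.d32 ≫ X.d20 = X.d30 ≫ X.d21 := X.isPullback₂.lift_fst _ _ _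

theorem d32_d22 : X.d32 ≫ X.d22 = X.d33 ≫ T.map X.d22 ≫ T.μ.app X.X₁ :=
  X.isPullback₂.lift_snd _ _ _

theorem s10_d20 : X.s10 ≫ X.d20 = 𝟙 X.X₁ := X.isPullback₂.lift_fst _ _ _

theorem s10_d22 : X.s10 ≫ X.d22 = X.d₁ ≫ T.map X.s₀ := X.isPullback₂.lift_snd _ _ _

theorem s11_d20 : X.s11 ≫ X.d20 = X.d₀ ≫ X.s₀ := X.isPullback₂.lift_fst _ _ _

theorem s11_d22 : X.s11 ≫ X.d22 = T.η.app X.X₁ := X.isPullback₂.lift_snd _ _ _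

/-- The target of a composable triple. -/
def tgt₃ : X.X₃ ⟶ T.obj X.X₀ :=
  X.d33 ≫ T.map (X.d22 ≫ T.map X.d₁ ≫ T.μ.app X.X₀) ≫ T.μ.app X.X₀

/-- Both sides of each law have the same source and target. The laws thus become equations between
graph morphisms that are the identity on vertices, with values in a right adjoint functor to
`T`-graphs, as the equifier theorem requires; `arr` alone would not do. -/
theorem d31_d21_d₀ : X.d31 ≫ X.d21 ≫ X.d₀ = X.d30 ≫ X.d20 ≫ X.d₀ := by
  rw [X.d21_d₀, reassoc_of% d31_d20]

theorem d31_d21_d₁ : X.d31 ≫ X.d21 ≫ X.d₁ = X.tgt₃ := by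
  rw [X.d21_d₁, reassoc_of% d31_d22, ← T.map_comp_assoc, X.d21_d₁, tgt₃]

theorem d32_d21_d₀ : X.d32 ≫ X.d21 ≫ X.d₀ = X.d30 ≫ X.d20 ≫ X.d₀ := by
  rw [X.d21_d₀, reassoc_of% d32_d20, X.d21_d₀]

theorem d32_d21_d₁ : X.d32 ≫ X.d21 ≫ X.d₁ = X.tgt₃ := by
  have h : T.μ.app X.X₁ ≫ T.map X.d₁ = T.map (T.map X.d₁) ≫ T.μ.app _ :=
    (T.μ.naturality X.d₁).symm
  have h' : T.μ.app (T.obj X.X₀) ≫ T.μ.app X.X₀ = T.map (T.μ.app X.X₀) ≫ T.μ.app X.X₀ :=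
    (T.assoc X.X₀).symm
  rw [X.d21_d₁, reassoc_of% d32_d22, tgt₃]
  simp only [Category.assoc, Functor.map_comp]
  rw [reassoc_of% h, h']

theorem s10_d21_d₀ : X.s10 ≫ X.d21 ≫ X.d₀ = X.d₀ := by
  rw [X.d21_d₀, reassoc_of% s10_d20]

theorem s10_d21_d₁ : X.s10 ≫ X.d21 ≫ X.d₁ = X.d₁ := by
  rw [X.d21_d₁, reassoc_of% s10_d22, ← T.map_comp_assoc, X.s₀_d₁]
  exact (congrArg (X.d₁ ≫ ·) (T.right_unit X.X₀)).trans (Category.comp_id _)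

theorem s11_d21_d₀ : X.s11 ≫ X.d21 ≫ X.d₀ = X.d₀ := by
  rw [X.d21_d₀, reassoc_of% s11_d20, X.s₀_d₀, Category.comp_id]

theorem s11_d21_d₁ : X.s11 ≫ X.d21 ≫ X.d₁ = X.d₁ := by
  have h : T.η.app X.X₁ ≫ T.map X.d₁ = X.d₁ ≫ T.η.app (T.obj X.X₀) :=
    (T.η.naturality X.d₁).symm
  rw [X.d21_d₁, reassoc_of% s11_d22, reassoc_of% h]
  exact (congrArg (X.d₁ ≫ ·) (T.left_unit X.X₀)).trans (Category.comp_id _)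

/-- The associativity and unit laws. -/
structure IsLawful : Prop where
  assoc : X.d31 ≫ X.d21 = X.d32 ≫ X.d21
  s10_d21 : X.s10 ≫ X.d21 = 𝟙 X.X₁
  s11_d21 : X.s11 ≫ X.d21 = 𝟙 X.X₁

end

variable {X Y : TCategoryData T}

theorem f₂_d20 (f : X.toTGraph ⟶ Y.toTGraph) : f₂ f ≫ Y.d20 = X.d20 ≫ f.f₁ :=
  Y.isPullback₂.lift_fst _ _ _

theorem f₂_d22 (f : X.toTGraph ⟶ Y.toTGraph) : f₂ f ≫ Y.d22 = X.d22 ≫ T.map f.f₁ :=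
  Y.isPullback₂.lift_snd _ _ _

/-- The morphism on composable triples induced by a morphism of `T`-graphs. -/
noncomputable def f₃ (f : X.toTGraph ⟶ Y.toTGraph) : X.X₃ ⟶ Y.X₃ :=
  Y.isPullback₃.lift (X.d30 ≫ f₂ f) (X.d33 ≫ T.map (f₂ f)) (by
    rw [Category.assoc, f₂_d22, reassoc_of% X.isPullback₃.w, Category.assoc, ← T.map_comp,
      ← T.map_comp, f₂_d20])

theorem f₃_d30 (f : X.toTGraph ⟶ Y.toTGraph) : f₃ f ≫ Y.d30 = X.d30 ≫ f₂ f :=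
  Y.isPullback₃.lift_fst _ _ _

theorem f₃_d33 (f : X.toTGraph ⟶ Y.toTGraph) : f₃ f ≫ Y.d33 = X.d33 ≫ T.map (f₂ f) :=
  Y.isPullback₃.lift_snd _ _ _

/-- Compatibility of a morphism of `T`-graphs with units and composition. -/
structure IsCompatible (f : X.toTGraph ⟶ Y.toTGraph) : Prop where
  comm_s₀ : X.s₀ ≫ f.f₁ = f.f₀ ≫ Y.s₀
  comm_d21 : X.d21 ≫ f.f₁ = f₂ f ≫ Y.d21

namespace IsCompatible

variable {f : X.toTGraph ⟶ Y.toTGraph} (hf : IsCompatible f)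

include hf

theorem d31_f₂ : X.d31 ≫ f₂ f = f₃ f ≫ Y.d31 := by
  apply Y.isPullback₂.hom_ext
  · rw [Category.assoc, f₂_d20, reassoc_of% d31_d20, Category.assoc, d31_d20,
      reassoc_of% f₃_d30, f₂_d20]
  · rw [Category.assoc, f₂_d22, reassoc_of% d31_d22, Category.assoc, d31_d22, reassoc_of% f₃_d33,
      ← T.map_comp, ← T.map_comp, hf.comm_d21]

theorem d32_f₂ : X.d32 ≫ f₂ f = f₃ f ≫ Y.d32 := by
  apply Y.isPullback₂.hom_ext
  · rw [Category.assoc, f₂_d20, reassoc_of% d32_d20, Category.assoc, d32_d20, reassoc_of% f₃_d30,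
      hf.comm_d21]
  · have h : T.μ.app X.X₁ ≫ T.map f.f₁ = T.map (T.map f.f₁) ≫ T.μ.app Y.X₁ :=
      (T.μ.naturality f.f₁).symm
    rw [Category.assoc, f₂_d22, reassoc_of% d32_d22, Category.assoc, d32_d22, reassoc_of% f₃_d33, h,
      ← T.map_comp_assoc, ← T.map_comp_assoc, f₂_d22]

theorem s10_f₂ : X.s10 ≫ f₂ f = f.f₁ ≫ Y.s10 := by
  apply Y.isPullback₂.hom_ext
  · rw [Category.assoc, f₂_d20, reassoc_of% s10_d20, Category.assoc, s10_d20, Category.comp_id]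
  · rw [Category.assoc, f₂_d22, reassoc_of% s10_d22, Category.assoc, s10_d22, ← T.map_comp,
      hf.comm_s₀, T.map_comp, reassoc_of% f.comm_d₁]

theorem s11_f₂ : X.s11 ≫ f₂ f = f.f₁ ≫ Y.s11 := by
  apply Y.isPullback₂.hom_ext
  · rw [Category.assoc, f₂_d20, reassoc_of% s11_d20, Category.assoc, s11_d20, hf.comm_s₀,
      reassoc_of% f.comm_d₀]
  · rw [Category.assoc, f₂_d22, reassoc_of% s11_d22, Category.assoc, s11_d22]
    exact (T.η.naturality f.f₁).symm

/-- Both sides of a law in `X` become, after the monomorphism `f.f₁`, the corresponding sides in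
`Y`, by naturality of faces and degeneracies. With an identity for `f`, this moves the laws between
different choices of pullbacks. -/
theorem isLawful [Mono f.f₁] (hY : Y.IsLawful) : X.IsLawful where
  assoc := by
    rw [← cancel_mono f.f₁, Category.assoc, Category.assoc, hf.comm_d21,
      reassoc_of% hf.d31_f₂, reassoc_of% hf.d32_f₂, hY.assoc]
  s10_d21 := by
    rw [← cancel_mono f.f₁, Category.assoc, hf.comm_d21, reassoc_of% hf.s10_f₂, hY.s10_d21,
      Category.comp_id, Category.id_comp]
  s11_d21 := by
    rw [← cancel_mono f.f₁, Category.assoc, hf.comm_d21, reassoc_of% hf.s11_f₂, hY.s11_d21,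
      Category.comp_id, Category.id_comp]

end IsCompatible

end TCategoryData

/-! ### Composable pairs and triples, and the endofunctor of units and compositions -/

section Structure

variable [HasPullbacks E]

/-- The composable pairs of arrows of a `T`-graph. -/
noncomputable abbrev TGraph.pairs (X : TGraph T) : E := pullback X.d₁ (T.map X.d₀)

/-- The composable triples of arrows of a `T`-graph. -/
noncomputable abbrev TGraph.triples (X : TGraph T) : E :=
  pullback (pullback.snd X.d₁ (T.map X.d₀)) (T.map (pullback.fst X.d₁ (T.map X.d₀)))

/-- The morphism induced on composable pairs. -/
noncomputable def TGraph.pairsMap {X Y : TGraph T} (f : X ⟶ Y) : X.pairs ⟶ Y.pairs :=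
  pullback.map _ _ _ _ f.f₁ (T.map f.f₁) (T.map f.f₀) f.comm_d₁ (by
    rw [← T.map_comp, ← T.map_comp, f.comm_d₀])

@[simp]
theorem TGraph.pairsMap_fst {X Y : TGraph T} (f : X ⟶ Y) :
    pairsMap f ≫ pullback.fst _ _ = pullback.fst _ _ ≫ f.f₁ := pullback.lift_fst _ _ _

@[simp]
theorem TGraph.pairsMap_snd {X Y : TGraph T} (f : X ⟶ Y) :
    pairsMap f ≫ pullback.snd _ _ = pullback.snd _ _ ≫ T.map f.f₁ := pullback.lift_snd _ _ _

@[simp]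
theorem TGraph.pairsMap_id (X : TGraph T) : pairsMap (𝟙 X) = 𝟙 X.pairs := by
  apply pullback.hom_ext
  · rw [pairsMap_fst, Category.id_comp]
    exact Category.comp_id _
  · rw [pairsMap_snd, Category.id_comp]
    exact (congrArg (_ ≫ ·) (T.map_id X.X₁)).trans (Category.comp_id _)

theorem TGraph.pairsMap_comp {X Y Z : TGraph T} (f : X ⟶ Y) (g : Y ⟶ Z) :
    pairsMap (f ≫ g) = pairsMap f ≫ pairsMap g := by
  apply pullback.hom_ext <;> simp [reassoc_of% pairsMap_fst f, reassoc_of% pairsMap_snd f]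

/-- The morphism induced on composable triples. -/
noncomputable def TGraph.triplesMap {X Y : TGraph T} (f : X ⟶ Y) : X.triples ⟶ Y.triples :=
  pullback.map _ _ _ _ (pairsMap f) (T.map (pairsMap f)) (T.map f.f₁) (pairsMap_snd f).symm (by
    rw [← T.map_comp, ← T.map_comp, pairsMap_fst])

@[simp]
theorem TGraph.triplesMap_fst {X Y : TGraph T} (f : X ⟶ Y) :
    triplesMap f ≫ pullback.fst _ _ = pullback.fst _ _ ≫ pairsMap f := pullback.lift_fst _ _ _

@[simp]
theorem TGraph.triplesMap_snd {X Y : TGraph T} (f : X ⟶ Y) :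
    triplesMap f ≫ pullback.snd _ _ = pullback.snd _ _ ≫ T.map (pairsMap f) :=
  pullback.lift_snd _ _ _

theorem TGraph.triplesMap_id (X : TGraph T) : triplesMap (𝟙 X) = 𝟙 X.triples := by
  apply pullback.hom_ext <;> simp

theorem TGraph.triplesMap_comp {X Y Z : TGraph T} (f : X ⟶ Y) (g : Y ⟶ Z) :
    triplesMap (f ≫ g) = triplesMap f ≫ triplesMap g := by
  apply pullback.hom_ext <;>
    simp [pairsMap_comp, reassoc_of% triplesMap_fst f, reassoc_of% triplesMap_snd f]

variable (T)

/-- The functor sending a `T`-graph to its composable pairs. -/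
noncomputable def pairsFunctor : TGraph T ⥤ E where
  obj X := X.pairs
  map f := TGraph.pairsMap f
  map_id X := TGraph.pairsMap_id X
  map_comp f g := TGraph.pairsMap_comp f g

/-- The functor sending a `T`-graph to its composable triples. -/
noncomputable def triplesFunctor : TGraph T ⥤ E where
  obj X := X.triples
  map f := TGraph.triplesMap f
  map_id X := TGraph.triplesMap_id X
  map_comp f g := TGraph.triplesMap_comp f g

/-- The `T`-graph of composable triples. -/
noncomputable def triplesGraph : TGraph T ⥤ TGraph T where
  obj X :=
    { X₀ := X.X₀
      X₁ := X.triples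
      d₀ := pullback.fst _ _ ≫ pullback.fst _ _ ≫ X.d₀
      d₁ := pullback.snd _ _ ≫ T.map (pullback.snd _ _ ≫ T.map X.d₁ ≫ T.μ.app X.X₀) ≫
        T.μ.app X.X₀ }
  map {X Y} f :=
    { f₀ := f.f₀
      f₁ := TGraph.triplesMap f
      comm_d₀ := by
        simp [f.comm_d₀, reassoc_of% TGraph.triplesMap_fst f, reassoc_of% TGraph.pairsMap_fst f]
      comm_d₁ := by
        have h : T.μ.app X.X₀ ≫ T.map f.f₀ = T.map (T.map f.f₀) ≫ T.μ.app Y.X₀ :=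
          (T.μ.naturality f.f₀).symm
        simp only [Category.assoc, Functor.map_comp, reassoc_of% TGraph.triplesMap_snd]
        -- Naturality of the multiplication is used twice, for the outer one and, under `T`, for the
        -- inner one.
        rw [h, ← T.map_comp_assoc (T.μ.app _), h, ← T.map_comp_assoc (TGraph.pairsMap f),
          TGraph.pairsMap_snd]
        simp only [Category.assoc, Functor.map_comp]
        rw [← T.map_comp_assoc (T.map X.d₁), ← T.map_comp_assoc (T.map f.f₁), ← T.map_comp,
          ← T.map_comp, f.comm_d₁] }
  map_id X := TGraph.hom_ext rfl (TGraph.triplesMap_id X)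
  map_comp f g := TGraph.hom_ext rfl (TGraph.triplesMap_comp f g)

variable [HasBinaryCoproducts E]

/-- The functor whose algebras with identity underlying action on vertices are `T`-graphs
with units and a composition. -/
noncomputable def unitComp : TGraph T ⥤ TGraph T where
  obj X :=
    { X₀ := X.X₀
      -- The ends of these arrows are those prescribed for units and composites, so a graph morphism
      -- to `X` that is the identity on vertices amounts to `s₀` and `d21` with their source and
      -- target axioms.
      X₁ := X.X₀ ⨿ X.pairs
      d₀ := coprod.desc (𝟙 _) (pullback.fst _ _ ≫ X.d₀)
      d₁ := coprod.desc (T.η.app X.X₀) (pullback.snd _ _ ≫ T.map X.d₁ ≫ T.μ.app X.X₀) }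
  map {X Y} f :=
    { f₀ := f.f₀
      f₁ := coprod.map f.f₀ (TGraph.pairsMap f)
      comm_d₀ := by
        apply coprod.hom_ext <;> simp [f.comm_d₀, reassoc_of% TGraph.pairsMap_fst f]
      comm_d₁ := by
        have h : T.μ.app X.X₀ ≫ T.map f.f₀ = T.map (T.map f.f₀) ≫ T.μ.app Y.X₀ :=
          (T.μ.naturality f.f₀).symm
        apply coprod.hom_ext
        · rw [coprod.inl_desc_assoc, coprod.inl_map_assoc, coprod.inl_desc]
          exact (T.η.naturality f.f₀).symm
        · simp only [coprod.inr_desc_assoc, coprod.inr_map_assoc, coprod.inr_desc, Category.assoc,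
            reassoc_of% TGraph.pairsMap_snd]
          rw [h, ← T.map_comp_assoc, ← T.map_comp_assoc, f.comm_d₁] }
  map_id X := TGraph.hom_ext rfl (by simp)
  map_comp f g := TGraph.hom_ext rfl (by simp [TGraph.pairsMap_comp])

end Structure

end TCat

/-! ### Finitariness of the functors built from pairs and triples -/

namespace LFP

/-- Colimits commute with coproducts: a map out of `P` at the colimit is a pair of maps out of `A`
and `B`, each determined by a cocone. -/
theorem isFinitelyAccessible_of_isColimit_binaryCofan {K : Type u} [Category.{v} K]
    {L : Type*} [Category* L] {P A B : L ⥤ K}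
    [A.IsFinitelyAccessible.{v}] [B.IsFinitelyAccessible.{v}] (p : A ⟶ P) (q : B ⟶ P)
    (h : ∀ X, Nonempty (IsColimit (BinaryCofan.mk (p.app X) (q.app X)))) :
    P.IsFinitelyAccessible.{v} := by
  refine isFinitelyAccessible_of_forall fun J _ _ D c hc ↦ ?_
  have hfilt : IsCardinalFiltered J (ℵ₀ : Cardinal.{v}) := by
    rw [isCardinalFiltered_aleph0_iff]; infer_instance
  have (F : L ⥤ K) [F.IsFinitelyAccessible.{v}] : IsColimit (F.mapCocone c) :=
    have := F.preservesColimitsOfShape_of_isCardinalAccessible (ℵ₀ : Cardinal.{v}) J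
    isColimitOfPreserves F hc
  have hA := this A
  have hB := this B
  have hP (X : L) := (h X).some
  let sA (s : Cocone (D ⋙ P)) : Cocone (D ⋙ A) :=
    (Cocone.precompose (Functor.whiskerLeft D p)).obj s
  let sB (s : Cocone (D ⋙ P)) : Cocone (D ⋙ B) :=
    (Cocone.precompose (Functor.whiskerLeft D q)).obj s
  let desc (s : Cocone (D ⋙ P)) : P.obj c.pt ⟶ s.pt :=
    BinaryCofan.IsColimit.desc (hP c.pt) (hA.desc (sA s)) (hB.desc (sB s))
  have h₁ (s) : p.app c.pt ≫ desc s = hA.desc (sA s) :=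
    BinaryCofan.IsColimit.inl_desc (hP c.pt) _ _
  have h₂ (s) : q.app c.pt ≫ desc s = hB.desc (sB s) :=
    BinaryCofan.IsColimit.inr_desc (hP c.pt) _ _
  refine ⟨{ desc := desc, fac s j := ?_, uniq s m hm := ?_ }⟩
  · apply BinaryCofan.IsColimit.hom_ext (hP (D.obj j))
    · have e : p.app (D.obj j) ≫ P.map (c.ι.app j) = A.map (c.ι.app j) ≫ p.app c.pt :=
        (p.naturality _).symm
      exact (Category.assoc _ _ _).symm.trans ((congrArg (· ≫ desc s) e).trans
        ((Category.assoc _ _ _).trans ((congrArg (_ ≫ ·) (h₁ s)).trans (hA.fac (sA s) j))))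
    · have e : q.app (D.obj j) ≫ P.map (c.ι.app j) = B.map (c.ι.app j) ≫ q.app c.pt :=
        (q.naturality _).symm
      exact (Category.assoc _ _ _).symm.trans ((congrArg (· ≫ desc s) e).trans
        ((Category.assoc _ _ _).trans ((congrArg (_ ≫ ·) (h₂ s)).trans (hB.fac (sB s) j))))
  · apply BinaryCofan.IsColimit.hom_ext (hP c.pt)
    · refine (hA.hom_ext fun j ↦ ?_ : p.app c.pt ≫ m = p.app c.pt ≫ desc s)
      rw [h₁, hA.fac]
      simpa [sA] using congr(p.app _ ≫ $(hm j))
    · refine (hB.hom_ext fun j ↦ ?_ : q.app c.pt ≫ m = q.app c.pt ≫ desc s)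
      rw [h₂, hB.fac]
      simpa [sB] using congr(q.app _ ≫ $(hm j))

end LFP

namespace TCat

variable {E : Type u} [Category.{v} E] (T : Monad E)

section Accessible

variable [IsLocallyFinitelyPresentable.{v} E] [T.toFunctor.IsFinitelyAccessible.{v}]

instance [HasPullbacks E] : (pairsFunctor T).IsFinitelyAccessible.{v} :=
  isFinitelyAccessible_of_isPullback (A := arr T) (B := arr T ⋙ T.toFunctor)
    (C := ob T ⋙ T.toFunctor)
    (p := { app X := pullback.fst _ _, naturality _ _ f := TGraph.pairsMap_fst f })
    (q := { app X := pullback.snd _ _, naturality _ _ f := TGraph.pairsMap_snd f })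
    (f := { app X := X.d₁, naturality _ _ f := f.comm_d₁.symm })
    (g := { app X := T.map X.d₀
            naturality X Y f := by
              change T.map f.f₁ ≫ T.map Y.d₀ = T.map X.d₀ ≫ T.map f.f₀
              rw [← T.map_comp, ← T.map_comp, f.comm_d₀] })
    (fun X ↦ IsPullback.of_hasPullback X.d₁ (T.map X.d₀))

instance [HasPullbacks E] : (triplesFunctor T).IsFinitelyAccessible.{v} :=
  isFinitelyAccessible_of_isPullback (A := pairsFunctor T) (B := pairsFunctor T ⋙ T.toFunctor)
    (C := arr T ⋙ T.toFunctor)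
    (p := { app X := pullback.fst _ _, naturality _ _ f := TGraph.triplesMap_fst f })
    (q := { app X := pullback.snd _ _, naturality _ _ f := TGraph.triplesMap_snd f })
    (f := { app X := pullback.snd _ _, naturality _ _ f := TGraph.pairsMap_snd f })
    (g := { app X := T.map (pullback.fst _ _)
            naturality X Y f := by
              change T.map (TGraph.pairsMap f) ≫ T.map (pullback.fst _ _) =
                T.map (pullback.fst _ _) ≫ T.map f.f₁
              rw [← T.map_comp, ← T.map_comp, TGraph.pairsMap_fst] })
    (fun X ↦ IsPullback.of_hasPullback _ _)

instance [HasPullbacks E] : (triplesGraph T).IsFinitelyAccessible.{v} :=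
  have : (triplesGraph T ⋙ ob T).IsFinitelyAccessible.{v} :=
    inferInstanceAs (ob T).IsFinitelyAccessible
  have : (triplesGraph T ⋙ arr T).IsFinitelyAccessible.{v} :=
    inferInstanceAs (triplesFunctor T).IsFinitelyAccessible
  TGraph.isFinitelyAccessible_of_comp _

instance [HasPullbacks E] [HasBinaryCoproducts E] : (unitComp T).IsFinitelyAccessible.{v} :=
  have : (unitComp T ⋙ ob T).IsFinitelyAccessible.{v} :=
    inferInstanceAs (ob T).IsFinitelyAccessible
  have : (unitComp T ⋙ arr T).IsFinitelyAccessible.{v} :=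
    isFinitelyAccessible_of_isColimit_binaryCofan (A := ob T) (B := pairsFunctor T)
      { app _ := coprod.inl, naturality _ _ f := (coprod.inl_map f.f₀ (TGraph.pairsMap f)).symm }
      { app _ := coprod.inr, naturality _ _ f := (coprod.inr_map f.f₀ (TGraph.pairsMap f)).symm }
      (fun _ ↦ ⟨coprodIsCoprod _ _⟩)
  TGraph.isFinitelyAccessible_of_comp _

end Accessible

/-! ### Graphs with units and composition, and their laws as equifiers -/

section

variable [HasPullbacks E] [HasBinaryCoproducts E]

/-- The algebras whose action on vertices is the identity. -/
def actsTrivially : ObjectProperty (Endofunctor.Algebra (unitComp T)) :=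
  fun A ↦ A.str.f₀ = 𝟙 A.a.X₀

/-- `T`-graphs with units and a composition. -/
abbrev MagmaCat := (actsTrivially T).FullSubcategory

/-- The forgetful functor to `T`-graphs. -/
noncomputable def magmaForget : MagmaCat T ⥤ TGraph T :=
  (actsTrivially T).ι ⋙ Endofunctor.Algebra.forget _

/-- The action on vertices as a natural transformation. -/
noncomputable def actionOb : Endofunctor.Algebra.forget (unitComp T) ⋙ ob T ⟶
    Endofunctor.Algebra.forget (unitComp T) ⋙ ob T where
  app A := A.str.f₀
  naturality A B f := congrArg (fun φ : (unitComp T).obj A.a ⟶ B.a ↦ φ.f₀) f.h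

variable {T}

namespace MagmaCat

/-- The units and the composition. -/
noncomputable def act (A : MagmaCat T) : A.obj.a.X₀ ⨿ A.obj.a.pairs ⟶ A.obj.a.X₁ :=
  A.obj.str.f₁

theorem act_d₀ (A : MagmaCat T) :
    A.act ≫ A.obj.a.d₀ = coprod.desc (𝟙 _) (pullback.fst _ _ ≫ A.obj.a.d₀) :=
  A.obj.str.comm_d₀.symm.trans ((congrArg (_ ≫ ·) A.property).trans (Category.comp_id _))

theorem act_d₁ (A : MagmaCat T) :
    A.act ≫ A.obj.a.d₁ =
      coprod.desc (T.η.app _) (pullback.snd _ _ ≫ T.map A.obj.a.d₁ ≫ T.μ.app _) :=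
  A.obj.str.comm_d₁.symm.trans ((congrArg (_ ≫ T.map ·) A.property).trans
    ((congrArg (_ ≫ ·) (T.map_id _)).trans (Category.comp_id _)))

theorem map_act {A B : MagmaCat T} (g : A ⟶ B) :
    coprod.map g.hom.f.f₀ (TGraph.pairsMap g.hom.f) ≫ B.act = A.act ≫ g.hom.f.f₁ :=
  congrArg (fun φ : (unitComp T).obj A.obj.a ⟶ B.obj.a ↦ φ.f₁) g.hom.h

/-- The data of a `T`-category underlying a `T`-graph with units and a composition. -/
noncomputable def toData (A : MagmaCat T) : TCategoryData T where
  toTGraph := A.obj.a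
  X₂ := A.obj.a.pairs
  d20 := pullback.fst _ _
  d22 := pullback.snd _ _
  isPullback₂ := IsPullback.of_hasPullback _ _
  d21 := coprod.inr ≫ A.act
  s₀ := coprod.inl ≫ A.act
  d21_d₀ := by rw [Category.assoc, act_d₀, coprod.inr_desc]
  d21_d₁ := by rw [Category.assoc, act_d₁, coprod.inr_desc]
  s₀_d₀ := by rw [Category.assoc, act_d₀, coprod.inl_desc]
  s₀_d₁ := by rw [Category.assoc, act_d₁, coprod.inl_desc]
  X₃ := A.obj.a.triples
  d30 := pullback.fst _ _
  d33 := pullback.snd _ _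
  isPullback₃ := IsPullback.of_hasPullback _ _

theorem f₂_eq {A B : MagmaCat T} (f : A.toData.toTGraph ⟶ B.toData.toTGraph) :
    TCategoryData.f₂ f = TGraph.pairsMap f := by
  apply B.toData.isPullback₂.hom_ext
  · exact (TCategoryData.f₂_d20 f).trans (TGraph.pairsMap_fst f).symm
  · exact (TCategoryData.f₂_d22 f).trans (TGraph.pairsMap_snd f).symm

theorem f₃_eq {A B : MagmaCat T} (f : A.toData.toTGraph ⟶ B.toData.toTGraph) :
    TCategoryData.f₃ f = TGraph.triplesMap f := by
  apply B.toData.isPullback₃.hom_ext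
  · refine (TCategoryData.f₃_d30 f).trans (Eq.trans ?_ (TGraph.triplesMap_fst f).symm)
    rw [f₂_eq]
    rfl
  · refine (TCategoryData.f₃_d33 f).trans (Eq.trans ?_ (TGraph.triplesMap_snd f).symm)
    rw [f₂_eq]
    rfl

theorem isCompatible {A B : MagmaCat T} (g : A ⟶ B) :
    TCategoryData.IsCompatible (X := A.toData) (Y := B.toData) g.hom.f where
  comm_s₀ := by
    have h := congrArg (coprod.inl ≫ ·) (map_act g)
    exact (Category.assoc _ _ _).trans (h.symm.trans (coprod.inl_map_assoc _ _ _))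
  comm_d21 := by
    have h := congrArg (coprod.inr ≫ ·) (map_act g)
    exact (Category.assoc _ _ _).trans (h.symm.trans ((coprod.inr_map_assoc _ _ _).trans
      (congrArg (· ≫ B.toData.d21) (f₂_eq (A := A) (B := B) g.hom.f)).symm))

variable (T)

/-- Composition of a triple, starting with the last two arrows, as a natural transformation. -/
noncomputable def assocLeft : magmaForget T ⋙ triplesGraph T ⟶ magmaForget T where
  app A :=
    { f₀ := 𝟙 _
      f₁ := A.toData.d31 ≫ A.toData.d21
      comm_d₀ := (Category.comp_id _).trans
        (A.toData.d31_d21_d₀.symm.trans (Category.assoc _ _ _).symm)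
      comm_d₁ := ((congrArg (_ ≫ ·) (T.map_id _)).trans (Category.comp_id _)).trans
        (A.toData.d31_d21_d₁.symm.trans (Category.assoc _ _ _).symm) }
  naturality A B g := by
    apply TGraph.hom_ext
    · exact (Category.comp_id _).trans (Category.id_comp _).symm
    · have hg := isCompatible g
      have h₁ := hg.comm_d21
      have h₂ : A.toData.d31 ≫ TCategoryData.f₂ _ = TGraph.triplesMap g.hom.f ≫ B.toData.d31 :=
        hg.d31_f₂.trans (congrArg (· ≫ B.toData.d31) (f₃_eq (A := A) (B := B) g.hom.f))
      refine Eq.trans ?_ (Category.assoc _ _ _).symm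
      refine (Category.assoc _ _ _).symm.trans ?_
      refine (congrArg (· ≫ B.toData.d21) h₂.symm).trans ?_
      exact (Category.assoc _ _ _).trans (congrArg (A.toData.d31 ≫ ·) h₁.symm)

/-- Composition of a triple, starting with the first two arrows, as a natural transformation. -/
noncomputable def assocRight : magmaForget T ⋙ triplesGraph T ⟶ magmaForget T where
  app A :=
    { f₀ := 𝟙 _
      f₁ := A.toData.d32 ≫ A.toData.d21
      comm_d₀ := (Category.comp_id _).trans
        (A.toData.d32_d21_d₀.symm.trans (Category.assoc _ _ _).symm)
      comm_d₁ := ((congrArg (_ ≫ ·) (T.map_id _)).trans (Category.comp_id _)).trans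
        (A.toData.d32_d21_d₁.symm.trans (Category.assoc _ _ _).symm) }
  naturality A B g := by
    apply TGraph.hom_ext
    · exact (Category.comp_id _).trans (Category.id_comp _).symm
    · have hg := isCompatible g
      have h₁ := hg.comm_d21
      have h₂ : A.toData.d32 ≫ TCategoryData.f₂ _ = TGraph.triplesMap g.hom.f ≫ B.toData.d32 :=
        hg.d32_f₂.trans (congrArg (· ≫ B.toData.d32) (f₃_eq (A := A) (B := B) g.hom.f))
      refine Eq.trans ?_ (Category.assoc _ _ _).symm
      refine (Category.assoc _ _ _).symm.trans ?_
      refine (congrArg (· ≫ B.toData.d21) h₂.symm).trans ?_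
      exact (Category.assoc _ _ _).trans (congrArg (A.toData.d32 ≫ ·) h₁.symm)

/-- Composition with the units at the target, as a natural transformation. -/
noncomputable def unitLeft : magmaForget T ⟶ magmaForget T where
  app A :=
    { f₀ := 𝟙 _
      f₁ := A.toData.s10 ≫ A.toData.d21
      comm_d₀ := (Category.comp_id _).trans
        (A.toData.s10_d21_d₀.symm.trans (Category.assoc _ _ _).symm)
      comm_d₁ := ((congrArg (_ ≫ ·) (T.map_id _)).trans (Category.comp_id _)).trans
        (A.toData.s10_d21_d₁.symm.trans (Category.assoc _ _ _).symm) }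
  naturality A B g := by
    apply TGraph.hom_ext
    · exact (Category.comp_id _).trans (Category.id_comp _).symm
    · have hg := isCompatible g
      refine Eq.trans ?_ (Category.assoc _ _ _).symm
      refine (Category.assoc _ _ _).symm.trans ?_
      refine (congrArg (· ≫ B.toData.d21) hg.s10_f₂.symm).trans ?_
      exact (Category.assoc _ _ _).trans (congrArg (A.toData.s10 ≫ ·) hg.comm_d21.symm)

/-- Composition with the units at the source, as a natural transformation. -/
noncomputable def unitRight : magmaForget T ⟶ magmaForget T where
  app A :=
    { f₀ := 𝟙 _
      f₁ := A.toData.s11 ≫ A.toData.d21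
      comm_d₀ := (Category.comp_id _).trans
        (A.toData.s11_d21_d₀.symm.trans (Category.assoc _ _ _).symm)
      comm_d₁ := ((congrArg (_ ≫ ·) (T.map_id _)).trans (Category.comp_id _)).trans
        (A.toData.s11_d21_d₁.symm.trans (Category.assoc _ _ _).symm) }
  naturality A B g := by
    apply TGraph.hom_ext
    · exact (Category.comp_id _).trans (Category.id_comp _).symm
    · have hg := isCompatible g
      refine Eq.trans ?_ (Category.assoc _ _ _).symm
      refine (Category.assoc _ _ _).symm.trans ?_
      refine (congrArg (· ≫ B.toData.d21) hg.s11_f₂.symm).trans ?_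
      exact (Category.assoc _ _ _).trans (congrArg (A.toData.s11 ≫ ·) hg.comm_d21.symm)

/-- The `T`-graphs with units and a composition that satisfy the laws of a `T`-category. -/
def isLawful : ObjectProperty (MagmaCat T) := fun A ↦ A.toData.IsLawful

/-- All the transformations involved are the identity on vertices, so their equality at `A` is
exactly the law on arrows. -/
theorem isLawful_eq :
    isLawful T = ⨅ i : Fin 3, ![equifier (assocLeft T) (assocRight T),
      equifier (unitLeft T) (𝟙 _), equifier (unitRight T) (𝟙 _)] i := by
  ext A
  rw [iInf_apply, iInf_Prop_eq]
  simp only [Fin.forall_fin_succ, IsEmpty.forall_iff, and_true]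
  refine ⟨fun h ↦ ⟨TGraph.hom_ext rfl h.assoc, TGraph.hom_ext rfl h.s10_d21,
    TGraph.hom_ext rfl h.s11_d21⟩, fun h ↦ ⟨?_, ?_, ?_⟩⟩
  · exact congr(TGraph.Hom.f₁ $(h.1))
  · exact congr(TGraph.Hom.f₁ $(h.2.1))
  · exact congr(TGraph.Hom.f₁ $(h.2.2))

end MagmaCat

end

/-! ### Presentability of lawful graphs with units and composition -/

section Presentable

variable [IsLocallyFinitelyPresentable.{v} E] [T.toFunctor.IsFinitelyAccessible.{v}]
  [HasPullbacks E] [HasBinaryCoproducts E]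

/-- Trivial action on vertices is agreement with the identity transformation of the underlying
vertex functor, which is a finitary right adjoint as a composite of two such functors. -/
theorem isFinitaryOrthogonalityClass_actsTrivially :
    IsFinitaryOrthogonalityClass (actsTrivially T) :=
  isFinitaryOrthogonalityClass_equifier (actionOb T) (𝟙 _)

instance : IsLocallyFinitelyPresentable.{v} (MagmaCat T) :=
  (isFinitaryOrthogonalityClass_actsTrivially T).isLocallyFinitelyPresentable

instance : (magmaForget T).IsFinitelyAccessible.{v} :=
  have := (isFinitaryOrthogonalityClass_actsTrivially T).isFinitelyAccessible_ι
  inferInstanceAs ((actsTrivially T).ι ⋙ Endofunctor.Algebra.forget _).IsFinitelyAccessible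

instance : (magmaForget T).IsRightAdjoint :=
  have := (isFinitaryOrthogonalityClass_actsTrivially T).isRightAdjoint_ι
  inferInstanceAs ((actsTrivially T).ι ⋙ Endofunctor.Algebra.forget _).IsRightAdjoint

theorem isFinitaryOrthogonalityClass_isLawful :
    IsFinitaryOrthogonalityClass (MagmaCat.isLawful T) := by
  rw [MagmaCat.isLawful_eq]
  refine .iInf fun i ↦ ?_
  fin_cases i
  · exact isFinitaryOrthogonalityClass_equifier _ _
  · exact isFinitaryOrthogonalityClass_equifier _ _
  · exact isFinitaryOrthogonalityClass_equifier _ _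

end Presentable

end TCat

/-! ### Equivalence with `T`-categories -/

namespace TCat

variable {E : Type u} [Category.{v} E] {T : Monad E}

theorem TCategory.isLawful (X : TCategory T) : X.toTCategoryData.IsLawful where
  assoc := X.assoc
  s10_d21 := X.s10_d21
  s11_d21 := X.s11_d21

section

variable [HasPullbacks E]

namespace TCategoryData

variable (X : TCategoryData T)

/-- The comparison from the chosen pullback of composable pairs. -/
noncomputable def fromPairs : X.toTGraph.pairs ⟶ X.X₂ :=
  X.isPullback₂.lift (pullback.fst _ _) (pullback.snd _ _) pullback.condition

theorem fromPairs_d20 : X.fromPairs ≫ X.d20 = pullback.fst _ _ := X.isPullback₂.lift_fst _ _ _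

theorem fromPairs_d22 : X.fromPairs ≫ X.d22 = pullback.snd _ _ := X.isPullback₂.lift_snd _ _ _

instance : IsIso X.fromPairs := by
  refine ⟨pullback.lift X.d20 X.d22 X.isPullback₂.w, ?_, ?_⟩
  · apply pullback.hom_ext
    · rw [Category.assoc, pullback.lift_fst, fromPairs_d20, Category.id_comp]
    · rw [Category.assoc, pullback.lift_snd, fromPairs_d22, Category.id_comp]
  · apply X.isPullback₂.hom_ext
    · rw [Category.assoc, fromPairs_d20, pullback.lift_fst, Category.id_comp]
    · rw [Category.assoc, fromPairs_d22, pullback.lift_snd, Category.id_comp]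

variable {X} in
theorem pairsMap_fromPairs {Y : TCategoryData T} (f : X.toTGraph ⟶ Y.toTGraph) :
    TGraph.pairsMap f ≫ Y.fromPairs = X.fromPairs ≫ f₂ f := by
  apply Y.isPullback₂.hom_ext
  · rw [Category.assoc, Category.assoc, fromPairs_d20, f₂_d20, reassoc_of% fromPairs_d20,
      TGraph.pairsMap_fst]
  · rw [Category.assoc, Category.assoc, fromPairs_d22, f₂_d22, reassoc_of% fromPairs_d22,
      TGraph.pairsMap_snd]

variable [HasBinaryCoproducts E]

-- On the two summands the equation expresses compatibility with units and with composition; the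
-- isomorphism `fromPairs` exchanges the chosen $X_2$ for the canonical pullback.
variable {X} in
theorem isCompatible_iff {Y : TCategoryData T} (f : X.toTGraph ⟶ Y.toTGraph) :
    IsCompatible f ↔ coprod.map f.f₀ (TGraph.pairsMap f) ≫
      coprod.desc Y.s₀ (Y.fromPairs ≫ Y.d21) =
        coprod.desc X.s₀ (X.fromPairs ≫ X.d21) ≫ f.f₁ := by
  have h := pairsMap_fromPairs f
  refine ⟨fun hf ↦ ?_, fun hf ↦ ⟨?_, ?_⟩⟩
  · apply coprod.hom_ext
    · rw [coprod.inl_map_assoc, coprod.inl_desc, coprod.inl_desc_assoc, hf.comm_s₀]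
    · rw [coprod.inr_map_assoc, coprod.inr_desc, coprod.inr_desc_assoc, reassoc_of% h,
        Category.assoc, hf.comm_d21]
  · have := congrArg (coprod.inl ≫ ·) hf
    rw [coprod.inl_map_assoc, coprod.inl_desc, coprod.inl_desc_assoc] at this
    exact this.symm
  · have := congrArg (coprod.inr ≫ ·) hf
    rw [coprod.inr_map_assoc, coprod.inr_desc, coprod.inr_desc_assoc, reassoc_of% h,
      Category.assoc, cancel_epi] at this
    exact this.symm

/-- The action encoding the units and the composition. -/
noncomputable def action : (unitComp T).obj X.toTGraph ⟶ X.toTGraph where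
  f₀ := 𝟙 X.X₀
  f₁ := coprod.desc X.s₀ (X.fromPairs ≫ X.d21)
  comm_d₀ := by
    refine (Category.comp_id _).trans ?_
    refine Eq.symm ((coprod.desc_comp X.d₀ X.s₀ (X.fromPairs ≫ X.d21)).trans ?_)
    rw [X.s₀_d₀, Category.assoc, X.d21_d₀, reassoc_of% fromPairs_d20]
    rfl
  comm_d₁ := by
    refine ((congrArg (_ ≫ ·) (T.map_id _)).trans (Category.comp_id _)).trans ?_
    refine Eq.symm ((coprod.desc_comp X.d₁ X.s₀ (X.fromPairs ≫ X.d21)).trans ?_)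
    rw [X.s₀_d₁, Category.assoc, X.d21_d₁, reassoc_of% fromPairs_d22]
    rfl

/-- The underlying `T`-graph with units and a composition. -/
noncomputable def toMagmaCat : MagmaCat T := ⟨⟨X.toTGraph, X.action⟩, rfl⟩

/-- The identity graph morphism, regarded as changing the chosen pullbacks, lets the laws of `X` be
reflected to the version with canonical pullbacks. -/
theorem isCompatible_toMagmaCat :
    IsCompatible (X := X.toMagmaCat.toData) (Y := X) (𝟙 X.toTGraph) where
  comm_s₀ := (Category.comp_id _).trans ((coprod.inl_desc _ _).trans (Category.id_comp _).symm)
  comm_d21 := by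
    refine (Category.comp_id _).trans ((coprod.inr_desc _ _).trans ?_)
    refine congrArg (· ≫ X.d21) (X.isPullback₂.hom_ext ?_ ?_)
    · refine X.fromPairs_d20.trans (Eq.trans ?_
        (f₂_d20 (X := X.toMagmaCat.toData) (Y := X) (𝟙 X.toTGraph)).symm)
      exact (Category.comp_id _).symm
    · refine X.fromPairs_d22.trans (Eq.trans ?_
        (f₂_d22 (X := X.toMagmaCat.toData) (Y := X) (𝟙 X.toTGraph)).symm)
      exact ((congrArg (_ ≫ ·) (T.map_id _)).trans (Category.comp_id _)).symm

variable {X} in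
theorem IsLawful.toMagmaCat (hX : X.IsLawful) : MagmaCat.isLawful T X.toMagmaCat :=
  have : Mono (TGraph.Hom.f₁ (X := X.toMagmaCat.toData.toTGraph) (𝟙 X.toTGraph)) :=
    inferInstanceAs (Mono (𝟙 X.X₁))
  X.isCompatible_toMagmaCat.isLawful hX

end TCategoryData

variable [HasBinaryCoproducts E]

variable (T) in
/-- `T`-categories as `T`-graphs with lawful units and composition. -/
noncomputable def toLawful : TCategory T ⥤ (MagmaCat.isLawful T).FullSubcategory where
  obj X := ⟨X.toMagmaCat, X.isLawful.toMagmaCat⟩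
  map {X Y} f := ⟨⟨
    { f := f.toHom
      h := by
        apply TGraph.hom_ext
        · exact (Category.comp_id _).trans (Category.id_comp _).symm
        · exact (TCategoryData.isCompatible_iff f.toHom).1 ⟨f.comm_s₀, f.comm_d21⟩ }⟩⟩
  map_id _ := rfl
  map_comp _ _ := rfl

instance : (toLawful T).Faithful where
  map_injective h := TFunctor.ext congr($(h).hom.hom.f)

instance : (toLawful T).Full where
  map_surjective {X Y} g := by
    let φ : X.toTGraph ⟶ Y.toTGraph := g.hom.hom.f
    have hφ := (TCategoryData.isCompatible_iff φ).2 (MagmaCat.map_act g.hom)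
    exact ⟨⟨φ, hφ.comm_s₀, hφ.comm_d21⟩, rfl⟩

instance : (toLawful T).EssSurj where
  mem_essImage A := by
    -- This `T`-category uses the canonical pullbacks, so its `fromPairs` is the identity and its
    -- action is the given one.
    let X : TCategory T := ⟨A.obj.toData, A.property.assoc, A.property.s10_d21,
      A.property.s11_d21⟩
    refine ⟨X, ⟨ObjectProperty.isoMk _ (ObjectProperty.isoMk _
      (Endofunctor.Algebra.isoMk (Iso.refl A.obj.obj.a) ?_))⟩⟩
    have h : X.action = A.obj.obj.str := by
      apply TGraph.hom_ext
      · exact A.obj.property.symm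
      · apply coprod.hom_ext
        · exact coprod.inl_desc _ _
        · refine (coprod.inr_desc _ _).trans ?_
          have : X.fromPairs = 𝟙 _ := by
            apply X.isPullback₂.hom_ext
            · exact X.fromPairs_d20.trans (Category.id_comp _).symm
            · exact X.fromPairs_d22.trans (Category.id_comp _).symm
          rw [this]
          exact Category.id_comp _
    refine ((congrArg (· ≫ A.obj.obj.str) ((unitComp T).map_id _)).trans
      (Category.id_comp _)).trans ?_
    exact h.symm.trans (Category.comp_id _).symm

instance : (toLawful T).IsEquivalence where

end

section Presentable

variable [IsLocallyFinitelyPresentable.{v} E] [T.toFunctor.IsFinitelyAccessible.{v}]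
  [HasPullbacks E] [HasBinaryCoproducts E]

instance : IsLocallyFinitelyPresentable.{v} (TCategory T) :=
  have := (isFinitaryOrthogonalityClass_isLawful T).isLocallyFinitelyPresentable
  (toLawful T).asEquivalence.symm.isCardinalLocallyPresentable _

instance : (forget T).IsFinitelyAccessible.{v} :=
  have := (isFinitaryOrthogonalityClass_isLawful T).isFinitelyAccessible_ι
  inferInstanceAs
    (toLawful T ⋙ (MagmaCat.isLawful T).ι ⋙ magmaForget T).IsFinitelyAccessible

instance : (forget T).IsRightAdjoint :=
  have := (isFinitaryOrthogonalityClass_isLawful T).isRightAdjoint_ι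
  inferInstanceAs (toLawful T ⋙ (MagmaCat.isLawful T).ι ⋙ magmaForget T).IsRightAdjoint

end Presentable

end TCat

end

theorem theorem2p7 {E : Type u} [Category.{v} E] (T : Monad E)
    (hE : IsLocallyFinitelyPresentable.{v} E)
    (hT : T.toFunctor.IsFinitelyAccessible.{v}) :
    IsLocallyFinitelyPresentable.{v} (TCat.TGraph T) ∧
    IsLocallyFinitelyPresentable.{v} (TCat.TCategory T) ∧
    (TCat.forget T).IsFinitelyAccessible.{v} ∧ (TCat.forget T).IsRightAdjoint ∧
    (TCat.ob T).IsFinitelyAccessible.{v} ∧ (TCat.ob T).IsRightAdjoint := by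
  -- Completeness provides the pullbacks on which the instances for `TCategory` and `forget` depend.
  have := LFP.hasLimits (K := E)
  exact ⟨inferInstance, inferInstance, inferInstance, inferInstance, inferInstance,
    inferInstance⟩
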